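/- Let $d\ge 0$ and let $\mathbb X$ be the space of paths $x:[0,1]\to\mathbb R^d$ of the form $x_t=\int_0^t\dot x_s\,ds$ with $\dot x\in L^2([0,1];\mathbb R^d)$, normed by $\|x\|_{\mathbb X}=\|\dot x\|_{L^2}$. Let $\varphi:\mathbb R\to\mathbb R$ be Lipschitz and linearly bounded, i.e. $|\varphi(u)|\le C_0(1+|u|)$ for some $C_0>0$ and all $u$; $\varphi$ also denotes its componentwise extension to $\mathbb R^N$. Let $\sigma_a,\sigma_A,\sigma_b\ge 0$. For $N\ge 1$ let $v^N,a\in\mathbb R^N$, $A_1,\dots,A_d\in\mathbb R^{N\times N}$, $b_1,\dots,b_d\in\mathbb R^N$ be random with jointly independent entries $[v^N]_\alpha\sim\mathcal N(0,\tfrac1N)$, $[a]_\alpha\sim\mathcal N(0,\sigma_a^2)$, $[A_k]_\alpha^\beta\sim\mathcal N(0,\tfrac{\sigma_A^2}{N})$, $[b_k]_\alpha\sim\mathcal N(0,\sigma_b^2)$. For $x\in\mathbb X$ and a partition $\mathcal D_M=\{0=t_0<\dots<t_M=1\}$ with mesh $|\mathcal D_M|=\max_i(t_{i+1}-t_i)$,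 the homogeneous controlled ResNet is $$S^{M,N}_{t_0}=a,\qquad S^{M,N}_{t_{i+1}}=S^{M,N}_{t_i}+\sum_{k=1}^d\big(A_k\varphi(S^{M,N}_{t_i})+b_k\big)(x^k_{t_{i+1}}-x^k_{t_i}),$$ extended to $t\in[0,1]$ by $$S^{M,N}_t(x)=a+\sum_{k=1}^d\int_0^t\big(A_k\varphi(S^{M,N}_{\rho_M(s)})+b_k\big)\,dx^k_s,\qquad \rho_M(s)=\sup\{r\in\mathcal D_M: r\le s\}.$$ Then, for every realisation of the weights, the neural controlled differential equation $$S^N_t(x)=a+\sum_{k=1}^d\int_0^t\big(A_k\varphi(S^N_s(x))+b_k\big)\,dx^k_s,\qquad t\in[0,1],$$ has a unique continuous solution $S^N(x)$, and $\langle v^N,S^{M,N}_t(x)\rangle$ and $\langle v^N,S^N_t(x)\rangle$ are random variables for every $t\in[0,1]$; denote their laws by $\mu^{M,N}_t(x)$ and $\mu^N_t(x)$. Moreover, there is a nondecreasing function $\mathbf K:\mathbb R\to(0,\infty)$, depending only on $d,\varphi,\sigma_a,\sigma_A,\sigma_b$, such that for every $x\in\mathbb X$ and every partition $\mathcal D_M$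 of $[0,1]$ $$\sup_{N\ge1}\ \sup_{t\in[0,1]}\ \mathcal W_1\big(\mu^{M,N}_t(x),\mu^N_t(x)\big)\le \mathbf K(\|x\|_{\mathbb X})\,\sqrt{|\mathcal D_M|},$$ where $\mathcal W_1$ is the 1-Wasserstein distance. -/

import Mathlib

open MeasureTheory ProbabilityTheory Set
open scoped ENNReal NNReal

noncomputable section

/-- A path `x : [0,1] → ℝᵈ` started at the origin with a square-integrable derivative `ẋ`, that is
`x t = ∫₀ᵗ ẋ s ds` on `[0,1]` with `ẋ ∈ L²([0,1]; ℝᵈ)`. The values outside `[0,1]` play no role. -/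
structure CMPath (d : ℕ) where
  /-- the path `x` -/
  toFun : ℝ → EuclideanSpace ℝ (Fin d)
  /-- its derivative `ẋ` (determined by `x` almost everywhere on `[0,1]`) -/
  velocity : ℝ → EuclideanSpace ℝ (Fin d)
  memLp_velocity : MemLp velocity 2 (volume.restrict (Icc 0 1))
  eq_integral : ∀ t ∈ Icc (0 : ℝ) 1, toFun t = ∫ s in (0 : ℝ)..t, velocity s

/-- The norm `‖x‖_𝕏 = ‖ẋ‖_{L²}`. -/
def CMPath.pathNorm {d : ℕ} (x : CMPath d) : ℝ :=
  √(∫ s in (0 : ℝ)..1, ‖x.velocity s‖ ^ 2)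

/-- A partition `0 = t₀ < t₁ < ⋯ < t_M = 1` of `[0,1]`. The values `pt i` with `i > M` play no
role. -/
structure UnitPartition where
  /-- the number `M` of subintervals -/
  size : ℕ
  /-- the partition points `t_i` -/
  pt : ℕ → ℝ
  pt_zero : pt 0 = 0
  pt_size : pt size = 1
  pt_lt : ∀ i < size, pt i < pt (i + 1)

/-- The mesh `|𝒟| = max_i (t_{i+1} - t_i)`. -/
def UnitPartition.mesh (D : UnitPartition) : ℝ :=
  ⨆ i : Fin D.size, (D.pt (i + 1) - D.pt i)

open Classical in
/-- The largest `i ≤ M` with `t_i ≤ t`, so that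
`D.pt (D.index t) = ρ(t) = sup {s ∈ 𝒟 : s ≤ t}` for `t ∈ [0,1]`. -/
def UnitPartition.index (D : UnitPartition) (t : ℝ) : ℕ :=
  Nat.findGreatest (fun i => D.pt i ≤ t) D.size

/-- The weights of the width-`N` network, in the order `(v, a, A, b)`: readout vector `v ∈ ℝᴺ`,
initial state `a ∈ ℝᴺ`, matrices `A₁, …, A_d ∈ ℝᴺˣᴺ` and biases `b₁, …, b_d ∈ ℝᴺ`. -/
abbrev Weights (d N : ℕ) : Type :=
  (Fin N → ℝ) × (Fin N → ℝ) × (Fin d → Fin N → Fin N → ℝ) × (Fin d → Fin N → ℝ)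

namespace Weights

variable {d N : ℕ}

/-- the readout vector `v` -/
def readoutVec (θ : Weights d N) : EuclideanSpace ℝ (Fin N) := WithLp.toLp 2 θ.1

/-- the initial state `a` -/
def init (θ : Weights d N) : EuclideanSpace ℝ (Fin N) := WithLp.toLp 2 θ.2.1

/-- the matrices `A_k` -/
def mat (θ : Weights d N) (k : Fin d) : Matrix (Fin N) (Fin N) ℝ := Matrix.of (θ.2.2.1 k)

/-- the biases `b_k` -/
def bias (θ : Weights d N) (k : Fin d) : Fin N → ℝ := θ.2.2.2 k

/-- The vector field `y ↦ A_k φ(y) + b_k` on `ℝᴺ`, with `φ` applied componentwise. -/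
def field (θ : Weights d N) (φ : ℝ → ℝ) (k : Fin d) (y : EuclideanSpace ℝ (Fin N)) :
    EuclideanSpace ℝ (Fin N) :=
  WithLp.toLp 2 (Matrix.mulVec (θ.mat k) (fun α => φ (y α)) + θ.bias k)

/-- The sampling law of the weights: all entries are independent, with
`v_α ∼ 𝒩(0, 1/N)`, `a_α ∼ 𝒩(0, σ_a²)`, `(A_k)_{αβ} ∼ 𝒩(0, σ_A²/N)`, `(b_k)_α ∼ 𝒩(0, σ_b²)`. -/
def law (d N : ℕ) (σa σA σb : ℝ) : Measure (Weights d N) :=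
  (Measure.pi fun _ => gaussianReal 0 (1 / (N : ℝ)).toNNReal).prod
    ((Measure.pi fun _ => gaussianReal 0 (σa ^ 2).toNNReal).prod
      ((Measure.pi fun _ => Measure.pi fun _ => Measure.pi fun _ =>
          gaussianReal 0 (σA ^ 2 / (N : ℝ)).toNNReal).prod
        (Measure.pi fun _ => Measure.pi fun _ => gaussianReal 0 (σb ^ 2).toNNReal)))

end Weights

section Models

variable {d N : ℕ}

/-- The states `S_{t_i}` of the homogeneous controlled ResNet on the partition `D`:
`S_{t_0} = a` and `S_{t_{i+1}} = S_{t_i} + ∑ₖ (A_k φ(S_{t_i}) + b_k) (xᵏ_{t_{i+1}} - xᵏ_{t_i})`. -/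
def resNetGrid (φ : ℝ → ℝ) (x : CMPath d) (D : UnitPartition) (θ : Weights d N) :
    ℕ → EuclideanSpace ℝ (Fin N)
  | 0 => θ.init
  | i + 1 => resNetGrid φ x D θ i +
      ∑ k : Fin d, (x.toFun (D.pt (i + 1)) k - x.toFun (D.pt i) k) •
        θ.field φ k (resNetGrid φ x D θ i)

/-- The piecewise constant extension `Z_t = S_{ρ(t)}` of the grid states. -/
def resNetPiecewise (φ : ℝ → ℝ) (x : CMPath d) (D : UnitPartition) (θ : Weights d N) (t : ℝ) :
    EuclideanSpace ℝ (Fin N) :=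
  resNetGrid φ x D θ (D.index t)

/-- The integral extension `S_t = a + ∑ₖ ∫₀ᵗ (A_k φ(Z_s) + b_k) dxᵏ_s` of the grid states, with
`dxᵏ_s = ẋᵏ_s ds`. -/
def resNetState (φ : ℝ → ℝ) (x : CMPath d) (D : UnitPartition) (θ : Weights d N) (t : ℝ) :
    EuclideanSpace ℝ (Fin N) :=
  θ.init + ∑ k : Fin d, ∫ s in (0 : ℝ)..t,
    x.velocity s k • θ.field φ k (resNetPiecewise φ x D θ s)

/-- `S` is a (continuous) solution on `[0,1]` of the neural controlled differential equation
`S_t = a + ∑ₖ ∫₀ᵗ (A_k φ(S_s) + b_k) dxᵏ_s`, with `dxᵏ_s = ẋᵏ_s ds`. -/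
def IsNeuralCDESolution (φ : ℝ → ℝ) (x : CMPath d) (θ : Weights d N)
    (S : ℝ → EuclideanSpace ℝ (Fin N)) : Prop :=
  ContinuousOn S (Icc 0 1) ∧
    ∀ t ∈ Icc (0 : ℝ) 1, S t = θ.init + ∑ k : Fin d, ∫ s in (0 : ℝ)..t,
      x.velocity s k • θ.field φ k (S s)

open Classical in
/-- The solution of the neural controlled differential equation (the randomized signature of `x`);
the zero function if there is no solution. -/
def neuralCDEState (φ : ℝ → ℝ) (x : CMPath d) (θ : Weights d N) :
    ℝ → EuclideanSpace ℝ (Fin N) :=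
  if h : ∃ S, IsNeuralCDESolution φ x θ S then h.choose else 0

/-- The readout `⟨v, S_t⟩` of the controlled ResNet on the partition `D`. -/
def resNetReadout (φ : ℝ → ℝ) (x : CMPath d) (D : UnitPartition) (t : ℝ) (θ : Weights d N) : ℝ :=
  inner ℝ θ.readoutVec (resNetState φ x D θ t)

/-- The readout `⟨v, S_t⟩` of the neural controlled differential equation. -/
def neuralCDEReadout (φ : ℝ → ℝ) (x : CMPath d) (t : ℝ) (θ : Weights d N) : ℝ :=
  inner ℝ θ.readoutVec (neuralCDEState φ x θ t)

end Models

/-- The 1-Wasserstein distance: the infimum of `∫ dist(y, z) dπ(y, z)` over all couplings `π` of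
`μ` and `ν`. -/
def wasserstein1 {E : Type*} [MeasurableSpace E] [PseudoEMetricSpace E] (μ ν : Measure E) : ℝ≥0∞ :=
  ⨅ (π : Measure (E × E)) (_ : π.fst = μ ∧ π.snd = ν), ∫⁻ p, edist p.1 p.2 ∂π

end

/-! The two networks share their weights, so the joint law of the readouts is a coupling and `W₁` is
at most the mean of `|⟨v, y⟩|`, where `y` is the difference of the two states. Two ingredients bound
this mean.

Pathwise, the ResNet solves the differential equation with its state `S` replaced, inside the vector
field, by the piecewise constant `Z`. A discrete Grönwall argument bounds the grid states by `‖a‖ +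
√N + ∑ ‖b_k‖` times an exponential of the operator norms of the `A_k`. Cauchy–Schwarz for `ẋ` over
one mesh interval then makes `S - Z` of order `√mesh`. Grönwall with the integrable kernel `‖ẋ‖`
carries this to `y`, at the cost of another exponential of the operator norms
(`norm_resNetState_sub_neuralCDEState_le`).

In expectation, `v` is independent of `y`, so `⟨v, y⟩` is conditionally Gaussian with standard
deviation `‖y‖ / √N`, and this `1 / √N` compensates the growth of `‖a‖ + √N + ∑ ‖b_k‖`. What remains
is an exponential moment of the operator norm that is uniform in `N`
(`lintegral_exp_opNorm_gaussianMatrix_le`). The exponential of `l‖A‖/2` is dominated by an average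
of `exp (l ⟨u, A v⟩)` over `u, v` in a fixed ball; the loss is a volume ratio `256 ^ N`. Since the
entries have variance of order `1 / N`, the choice `l = 2cN` bounds the mean of `exp (c‖A‖) ^ N` by
an `N`-th power, and Jensen removes the exponent.

Existence is a contraction in an exponentially weighted supremum norm. Measurability of the solution
follows because it is the limit of ResNets on uniform partitions. -/

/-! ### Grönwall and Picard for integrable kernels. -/

/-- The sums of increments grow by a factor of at most `K`. Lipschitz continuity is asked only on a
set containing the range, which is what the exponential offers. -/
theorem AbsolutelyContinuousOnInterval.lipschitzOnWith_comp {f h : ℝ → ℝ} {a b : ℝ} {s : Set ℝ}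
    {K : ℝ≥0} (hf : AbsolutelyContinuousOnInterval f a b) (hh : LipschitzOnWith K h s)
    (hs : MapsTo f (uIcc a b) s) : AbsolutelyContinuousOnInterval (fun t => h (f t)) a b := by
  refine squeeze_zero' (g := fun E => K * ∑ i ∈ Finset.range E.1, dist (f (E.2 i).1) (f (E.2 i).2))
    (Filter.Eventually.of_forall fun _ => Finset.sum_nonneg fun _ _ => dist_nonneg) ?_ ?_
  · rw [Filter.eventually_inf_principal]
    refine Filter.Eventually.of_forall fun E hE => ?_
    rw [Finset.mul_sum]
    exact Finset.sum_le_sum fun i hi =>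
      hh.dist_le_mul _ (hs (hE.1 i hi).1) _ (hs (hE.1 i hi).2)
  · simpa using Filter.Tendsto.const_mul (K : ℝ) hf

/-- The chain rule for the exponential of an absolutely continuous primitive. -/
theorem integral_mul_exp_two_mul_primitive {g : ℝ → ℝ} (hg : IntervalIntegrable g volume 0 1)
    {t : ℝ} (ht : t ∈ Icc (0 : ℝ) 1) :
    ∫ s in (0 : ℝ)..t, g s * Real.exp (2 * ∫ r in (0 : ℝ)..s, g r) =
      (Real.exp (2 * ∫ r in (0 : ℝ)..t, g r) - 1) / 2 := by
  have hsub : uIcc (0 : ℝ) t ⊆ uIcc 0 1 := by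
    rw [uIcc_of_le ht.1, uIcc_of_le zero_le_one]; exact Icc_subset_Icc_right ht.2
  have hgt : IntervalIntegrable g volume 0 t := hg.mono_set hsub
  have hac := hgt.absolutelyContinuousOnInterval_intervalIntegral (c := 0) (by simp)
  obtain ⟨B, hB⟩ := hac.exists_bound
  -- The primitive is bounded and the exponential is Lipschitz on bounded intervals, so the
  -- composite is absolutely continuous and the fundamental theorem of calculus applies although `g`
  -- is only integrable.
  have hexp : ContDiff ℝ 1 fun y : ℝ => Real.exp (2 * y) := by fun_prop
  obtain ⟨K, hK⟩ := hexp.contDiffOn.exists_lipschitzOnWith (s := Icc (-B) B) (by decide)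
    (convex_Icc _ _) isCompact_Icc
  have hE := hac.lipschitzOnWith_comp hK fun s hs => abs_le.1 (hB s hs)
  have h := hE.integral_deriv_eq_sub
  simp only [intervalIntegral.integral_same, mul_zero, Real.exp_zero] at h
  rw [← h, ← intervalIntegral.integral_div]
  refine intervalIntegral.integral_congr_ae ?_
  filter_upwards [hgt.ae_hasDerivAt_integral] with s hs hst
  have hd := ((hs (uIoc_subset_uIcc hst) 0 (by simp)).const_mul 2).exp
  rw [hd.deriv]
  ring

theorem IntervalIntegrable.continuousOn_primitive_Icc {E : Type*} [NormedAddCommGroup E]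
    [NormedSpace ℝ E] {f : ℝ → E} (hf : IntervalIntegrable f volume 0 1) :
    ContinuousOn (fun t => ∫ s in (0 : ℝ)..t, f s) (Icc 0 1) := by
  have := intervalIntegral.continuousOn_primitive_interval' hf (a := 0) (by simp)
  rwa [uIcc_of_le zero_le_one] at this

/-- **Grönwall's inequality** with an integrable kernel. -/
theorem le_mul_exp_of_le_add_integral_mul {g u : ℝ → ℝ} {c : ℝ}
    (hg : IntervalIntegrable g volume 0 1) (hg0 : ∀ s, 0 ≤ g s)
    (hu : ContinuousOn u (Icc 0 1)) (hc : 0 ≤ c)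
    (h : ∀ t ∈ Icc (0 : ℝ) 1, u t ≤ c + ∫ s in (0 : ℝ)..t, g s * u s) {t : ℝ}
    (ht : t ∈ Icc (0 : ℝ) 1) :
    u t ≤ 2 * c * Real.exp (2 * ∫ s in (0 : ℝ)..t, g s) := by
  have hG := hg.continuousOn_primitive_Icc
  set G : ℝ → ℝ := fun t => ∫ s in (0 : ℝ)..t, g s with hGdef
  -- Let `m` be the maximum of the weighted function `u * exp (-2G)`. Inserting `u ≤ m * exp (2G)`
  -- into the hypothesis bounds `m` by itself with a factor of about one half.
  have hw : ContinuousOn (fun t => u t * Real.exp (-(2 * G t))) (Icc 0 1) := by fun_prop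
  obtain ⟨τ, hτ, hmax⟩ := isCompact_Icc.exists_isMaxOn ⟨0, by simp⟩ hw
  set m := u τ * Real.exp (-(2 * G τ)) with hm
  have hle : ∀ s ∈ Icc (0 : ℝ) 1, u s ≤ m * Real.exp (2 * G s) := fun s hs => by
    have := hmax hs
    simp only [mem_ofPred_eq] at this
    calc u s = u s * Real.exp (-(2 * G s)) * Real.exp (2 * G s) := by
          rw [mul_assoc, ← Real.exp_add]; simp
      _ ≤ _ := by gcongr
  have hGnn : 0 ≤ G τ := intervalIntegral.integral_nonneg hτ.1 fun s _ => hg0 s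
  have key : ∀ s ∈ Icc (0 : ℝ) 1, u s ≤ c + m * ((Real.exp (2 * G s) - 1) / 2) := fun s hs => by
    refine (h s hs).trans ?_
    have hsub : uIcc (0 : ℝ) s ⊆ Icc 0 1 := by
      rw [uIcc_of_le hs.1]; exact Icc_subset_Icc_right hs.2
    have hgs : IntervalIntegrable g volume 0 s :=
      hg.mono_set (by rwa [uIcc_of_le zero_le_one])
    have hGs : ContinuousOn G (uIcc 0 s) := hG.mono hsub
    rw [← integral_mul_exp_two_mul_primitive hg hs, ← intervalIntegral.integral_const_mul]
    gcongr
    refine intervalIntegral.integral_mono_on hs.1 (hgs.mul_continuousOn (hu.mono hsub)) ?_ ?_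
    · exact (hgs.mul_continuousOn (f := g) (g := fun s => Real.exp (2 * G s)) (by fun_prop)).const_mul m
    · intro r hr
      have := hle r ⟨hr.1, hr.2.trans hs.2⟩
      calc g r * u r ≤ g r * (m * Real.exp (2 * G r)) := by gcongr; exact hg0 r
        _ = _ := by ring
  -- At the maximiser, `key` reads `m * (exp (2 * G τ) + 1) / 2 ≤ c`, where the exponential is at
  -- least `1`.
  have hm2 : m ≤ 2 * c := by
    by_contra! hlt
    have h1 := key τ hτ
    have he : u τ = m * Real.exp (2 * G τ) := by
      rw [hm, mul_assoc, ← Real.exp_add]; simp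
    have h2 : 1 ≤ Real.exp (2 * G τ) := Real.one_le_exp (by positivity)
    nlinarith
  exact (hle t ht).trans (by gcongr)

/-- The Picard–Carathéodory theorem for a vector field which is Lipschitz in space with an
integrable constant. -/
theorem exists_continuousOn_eq_add_integral {E : Type*} [NormedAddCommGroup E] [NormedSpace ℝ E]
    [CompleteSpace E] {F : ℝ → E → E} {g : ℝ → ℝ} (hg : IntervalIntegrable g volume 0 1)
    (hg0 : ∀ s, 0 ≤ g s)
    (hint : ∀ S : ℝ → E, ContinuousOn S (Icc 0 1) →
      IntervalIntegrable (fun s => F s (S s)) volume 0 1)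
    (hF : ∀ s y z, ‖F s y - F s z‖ ≤ g s * ‖y - z‖) (a : E) :
    ∃ S : ℝ → E, ContinuousOn S (Icc 0 1) ∧
      ∀ t ∈ Icc (0 : ℝ) 1, S t = a + ∫ s in (0 : ℝ)..t, F s (S s) := by
  set G : ℝ → ℝ := fun t => ∫ s in (0 : ℝ)..t, g s with hGdef
  have hG : ContinuousOn G (Icc 0 1) := hg.continuousOn_primitive_Icc
  have h01 : (0 : ℝ) ≤ 1 := zero_le_one
  -- The unknown is `y = exp (-2G) • S`, so that the plain supremum norm of `y` is a weighted norm
  -- of `S`; `ext` undoes the weight. The `2` in the exponent produces the contraction constant `1 /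
  -- 2`.
  let ext : C(Icc (0 : ℝ) 1, E) → ℝ → E := fun y s => Real.exp (2 * G s) • IccExtend h01 y s
  have hext : ∀ y, ContinuousOn (ext y) (Icc 0 1) := fun y => by
    have : Continuous (IccExtend h01 y) := y.continuous.Icc_extend'
    exact ContinuousOn.smul (by fun_prop) this.continuousOn
  let P : C(Icc (0 : ℝ) 1, E) → ℝ → E := fun y t => a + ∫ s in (0 : ℝ)..t, F s (ext y s)
  have hP : ∀ y, ContinuousOn (P y) (Icc 0 1) := fun y =>
    continuousOn_const.add (hint _ (hext y)).continuousOn_primitive_Icc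
  let Ψ : C(Icc (0 : ℝ) 1, E) → C(Icc (0 : ℝ) 1, E) := fun y =>
    ⟨fun t => Real.exp (-(2 * G t)) • P y t, by
      have : ContinuousOn (fun t => Real.exp (-(2 * G t)) • P y t) (Icc 0 1) :=
        ContinuousOn.smul (by fun_prop) (hP y)
      exact continuousOn_iff_continuous_domRestrict.1 this⟩
  have hΨ : ContractingWith (1 / 2 : ℝ≥0) Ψ := by
    refine ⟨by norm_num, LipschitzWith.of_dist_le_mul fun y z => ?_⟩
    rw [ContinuousMap.dist_le (by positivity)]
    rintro ⟨t, ht⟩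
    have hsub : uIcc (0 : ℝ) t ⊆ Icc 0 1 := by
      rw [uIcc_of_le ht.1]; exact Icc_subset_Icc_right ht.2
    have hsub' : uIcc (0 : ℝ) t ⊆ uIcc 0 1 := by rwa [uIcc_of_le h01]
    have hGs : ContinuousOn G (uIcc 0 t) := hG.mono hsub
    have hb : ‖P y t - P z t‖ ≤ dist y z * ((Real.exp (2 * G t) - 1) / 2) := by
      rw [← integral_mul_exp_two_mul_primitive hg ht, ← intervalIntegral.integral_const_mul]
      simp only [P, add_sub_add_left_eq_sub]
      rw [← intervalIntegral.integral_sub ((hint _ (hext y)).mono_set hsub')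
        ((hint _ (hext z)).mono_set hsub')]
      refine intervalIntegral.norm_integral_le_of_norm_le ht.1 (Filter.Eventually.of_forall
        fun s hs => ?_) (((hg.mono_set hsub').mul_continuousOn (f := g)
          (g := fun s => Real.exp (2 * G s)) (by fun_prop)).const_mul _)
      refine (hF _ _ _).trans ?_
      have : ‖ext y s - ext z s‖ ≤ Real.exp (2 * G s) * dist y z := by
        simp only [ext, ← smul_sub, norm_smul, Real.norm_eq_abs, Real.abs_exp]
        gcongr
        rw [← dist_eq_norm]
        exact ContinuousMap.dist_apply_le_dist _
      calc _ ≤ g s * (Real.exp (2 * G s) * dist y z) := by gcongr; exact hg0 s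
        _ = _ := by ring
    have : dist (Ψ y ⟨t, ht⟩) (Ψ z ⟨t, ht⟩) = Real.exp (-(2 * G t)) * ‖P y t - P z t‖ := by
      have hval : ∀ w, Ψ w ⟨t, ht⟩ = Real.exp (-(2 * G t)) • P w t := fun _ => rfl
      rw [hval, hval, dist_eq_norm, ← smul_sub, norm_smul, Real.norm_eq_abs, Real.abs_exp]
    rw [this]
    calc _ ≤ Real.exp (-(2 * G t)) * (dist y z * (Real.exp (2 * G t) / 2)) := by
          gcongr
          refine hb.trans ?_
          gcongr
          linarith
      _ = (Real.exp (-(2 * G t)) * Real.exp (2 * G t)) * (1 / 2) * dist y z := by ring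
      _ = _ := by rw [← Real.exp_add]; simp
  obtain ⟨y, hy⟩ : ∃ y, Ψ y = y := ⟨_, hΨ.fixedPoint_isFixedPt⟩
  have heq : EqOn (ext y) (P y) (Icc 0 1) := fun t ht => by
    have h1 : Real.exp (-(2 * G t)) • P y t = y ⟨t, ht⟩ := DFunLike.congr_fun hy ⟨t, ht⟩
    simp only [ext, IccExtend_of_mem h01 _ ht, ← h1, smul_smul, ← Real.exp_add]
    simp
  exact ⟨ext y, hext y, fun t ht => heq ht⟩

/-- The Cauchy–Schwarz inequality for the length of a path with square-integrable velocity. -/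
theorem integral_norm_le_sqrt_mul_sqrt {E : Type*} [NormedAddCommGroup E] {f : ℝ → E}
    (hf : MemLp f 2 (volume.restrict (Icc 0 1))) {s t : ℝ} (hs : 0 ≤ s) (hst : s ≤ t)
    (ht : t ≤ 1) :
    ∫ r in s..t, ‖f r‖ ≤ √(t - s) * √(∫ r in (0 : ℝ)..1, ‖f r‖ ^ 2) := by
  have hsub : Ioc s t ⊆ Icc 0 1 := fun r hr => ⟨hs.trans hr.1.le, hr.2.trans ht⟩
  have hft : MemLp f 2 (volume.restrict (Ioc s t)) := hf.mono_measure (Measure.restrict_mono hsub le_rfl)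
  have h := integral_mul_le_Lp_mul_Lq_of_nonneg (μ := volume.restrict (Ioc s t))
    (p := 2) (q := 2) (f := fun r => 1) (g := fun r => ‖f r‖) Real.HolderConjugate.two_two
    (Filter.Eventually.of_forall fun _ => zero_le_one)
    (Filter.Eventually.of_forall fun _ => norm_nonneg _) (memLp_const 1)
    (by simpa using hft.norm)
  rw [intervalIntegral.integral_of_le hst, intervalIntegral.integral_of_le zero_le_one]
  simp only [one_mul, Real.rpow_two, ← Real.sqrt_eq_rpow] at h
  refine h.trans ?_
  gcongr
  · simp [hst]
  · exact Filter.Eventually.of_forall fun _ => by positivity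
  · have := (hf.mono_measure (Measure.restrict_mono Ioc_subset_Icc_self le_rfl)).norm
    exact this.integrable_sq

/-! ### Paths and partitions. -/

noncomputable section

namespace CMPath

variable {d : ℕ}

theorem intervalIntegrable_velocity (x : CMPath d) :
    IntervalIntegrable x.velocity volume 0 1 := by
  rw [intervalIntegrable_iff_integrableOn_Icc_of_le zero_le_one]
  exact x.memLp_velocity.integrable one_le_two

theorem intervalIntegrable_velocity_of_mem (x : CMPath d) {s t : ℝ} (hs : s ∈ Icc (0 : ℝ) 1)
    (ht : t ∈ Icc (0 : ℝ) 1) : IntervalIntegrable x.velocity volume s t :=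
  x.intervalIntegrable_velocity.mono_set (by
    rw [uIcc_of_le (zero_le_one' ℝ)]; exact ordConnected_Icc.uIcc_subset hs ht)

theorem intervalIntegrable_norm_velocity (x : CMPath d) {s t : ℝ} (hs : s ∈ Icc (0 : ℝ) 1)
    (ht : t ∈ Icc (0 : ℝ) 1) : IntervalIntegrable (fun r => ‖x.velocity r‖) volume s t :=
  (x.intervalIntegrable_velocity_of_mem hs ht).norm

theorem pathNorm_nonneg (x : CMPath d) : 0 ≤ x.pathNorm := Real.sqrt_nonneg _

theorem integral_norm_velocity_le (x : CMPath d) {s t : ℝ} (hs : 0 ≤ s) (hst : s ≤ t)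
    (ht : t ≤ 1) : ∫ r in s..t, ‖x.velocity r‖ ≤ √(t - s) * x.pathNorm :=
  integral_norm_le_sqrt_mul_sqrt x.memLp_velocity hs hst ht

theorem integral_norm_velocity_le_pathNorm (x : CMPath d) {t : ℝ} (ht : t ∈ Icc (0 : ℝ) 1) :
    ∫ r in (0 : ℝ)..t, ‖x.velocity r‖ ≤ x.pathNorm := by
  refine (x.integral_norm_velocity_le le_rfl ht.1 ht.2).trans ?_
  refine mul_le_of_le_one_left x.pathNorm_nonneg ?_
  exact Real.sqrt_le_one.2 (by linarith [ht.2])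

theorem integral_velocity_apply (x : CMPath d) {s t : ℝ} (hs : s ∈ Icc (0 : ℝ) 1)
    (ht : t ∈ Icc (0 : ℝ) 1) (k : Fin d) :
    ∫ r in s..t, x.velocity r k = x.toFun t k - x.toFun s k := by
  have h := ContinuousLinearMap.intervalIntegral_comp_comm
    (EuclideanSpace.proj k : EuclideanSpace ℝ (Fin d) →L[ℝ] ℝ)
    (x.intervalIntegrable_velocity_of_mem hs ht)
  have h0 : (0 : ℝ) ∈ Icc (0 : ℝ) 1 := by simp
  have hadd := intervalIntegral.integral_add_adjacent_intervals
    (x.intervalIntegrable_velocity_of_mem h0 hs) (x.intervalIntegrable_velocity_of_mem hs ht)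
  rw [x.eq_integral t ht, x.eq_integral s hs, ← hadd]
  simpa using h

end CMPath

namespace UnitPartition

variable (D : UnitPartition)

theorem size_pos : 0 < D.size := by
  rcases Nat.eq_zero_or_pos D.size with h | h
  · have h1 := D.pt_size
    rw [h, D.pt_zero] at h1
    norm_num at h1
  · exact h

theorem pt_le_pt {i j : ℕ} (hij : i ≤ j) (hj : j ≤ D.size) : D.pt i ≤ D.pt j := by
  induction j, hij using Nat.le_induction with
  | base => exact le_rfl
  | succ j _ ih => exact (ih (by omega)).trans (D.pt_lt j (by omega)).le

theorem pt_mem {i : ℕ} (hi : i ≤ D.size) : D.pt i ∈ Icc (0 : ℝ) 1 :=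
  ⟨D.pt_zero ▸ D.pt_le_pt (Nat.zero_le i) hi, D.pt_size ▸ D.pt_le_pt hi le_rfl⟩

theorem sub_le_mesh {i : ℕ} (hi : i < D.size) : D.pt (i + 1) - D.pt i ≤ D.mesh :=
  le_ciSup (f := fun i : Fin D.size => D.pt (i + 1) - D.pt i) (Set.finite_range _).bddAbove ⟨i, hi⟩

theorem mesh_nonneg : 0 ≤ D.mesh :=
  (sub_nonneg.2 (D.pt_lt 0 D.size_pos).le).trans (D.sub_le_mesh D.size_pos)

theorem index_le (t : ℝ) : D.index t ≤ D.size := Nat.findGreatest_le _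

theorem pt_index_le {t : ℝ} (ht : 0 ≤ t) : D.pt (D.index t) ≤ t :=
  Nat.findGreatest_spec (P := fun i => D.pt i ≤ t) (Nat.zero_le D.size) (by rwa [D.pt_zero])

theorem lt_pt_succ_index {t : ℝ} (h : D.index t < D.size) : t < D.pt (D.index t + 1) :=
  not_le.1 (Nat.findGreatest_is_greatest (P := fun i => D.pt i ≤ t) (Nat.lt_succ_self _) h)

theorem index_eq {i : ℕ} (hi : i < D.size) {t : ℝ} (h1 : D.pt i ≤ t) (h2 : t < D.pt (i + 1)) :
    D.index t = i := by
  refine le_antisymm ?_ (Nat.le_findGreatest hi.le h1)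
  by_contra! h
  have h0 : 0 ≤ t := (D.pt_mem hi.le).1.trans h1
  exact absurd (h2.trans_le (D.pt_le_pt h (D.index_le t))) (not_lt.2 (D.pt_index_le h0))

theorem sub_pt_index_le_mesh {t : ℝ} (ht : t ∈ Icc (0 : ℝ) 1) : t - D.pt (D.index t) ≤ D.mesh := by
  rcases (D.index_le t).eq_or_lt with h | h
  · rw [h, D.pt_size]
    linarith [ht.2, D.mesh_nonneg]
  · linarith [D.lt_pt_succ_index h, D.sub_le_mesh h]

theorem measurable_index : Measurable D.index := by
  classical
  exact measurable_findGreatest fun k _ => measurableSet_le measurable_const measurable_id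

/-- The uniform partition into `n + 1` intervals. -/
def uniform (n : ℕ) : UnitPartition where
  size := n + 1
  pt i := i / (n + 1)
  pt_zero := by simp
  pt_size := by push_cast; field_simp
  pt_lt i _ := by push_cast; gcongr; linarith

theorem mesh_uniform_le (n : ℕ) : (uniform n).mesh ≤ 1 / (n + 1) := by
  have : Nonempty (Fin (uniform n).size) := ⟨⟨0, (uniform n).size_pos⟩⟩
  refine ciSup_le fun i => ?_
  simp only [uniform]
  push_cast
  rw [← sub_div]
  simp

end UnitPartition

/-! ### The driven vector field: bounds, existence, stability and uniqueness. -/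

namespace Weights

variable {d N : ℕ}

/-- The sum of the operator norms of the matrices. -/
def matNorm (θ : Weights d N) : ℝ :=
  ∑ k, ‖Matrix.toEuclideanCLM (𝕜 := ℝ) (θ.mat k)‖

/-- The sum of the Euclidean norms of the biases. -/
def biasNorm (θ : Weights d N) : ℝ := ∑ k, ‖(WithLp.toLp 2 (θ.bias k) : EuclideanSpace ℝ (Fin N))‖

theorem matNorm_nonneg (θ : Weights d N) : 0 ≤ θ.matNorm :=
  Finset.sum_nonneg fun _ _ => norm_nonneg _

theorem biasNorm_nonneg (θ : Weights d N) : 0 ≤ θ.biasNorm :=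
  Finset.sum_nonneg fun _ _ => norm_nonneg _

end Weights

section VectorField

variable {d N : ℕ} {φ : ℝ → ℝ}

theorem norm_componentwise_sub_le {L : ℝ≥0} (hφ : LipschitzWith L φ)
    (y z : EuclideanSpace ℝ (Fin N)) :
    ‖(WithLp.toLp 2 (fun i => φ (y i)) : EuclideanSpace ℝ (Fin N)) -
      WithLp.toLp 2 (fun i => φ (z i))‖ ≤ L * ‖y - z‖ := by
  rw [← abs_of_nonneg L.coe_nonneg, ← Real.norm_eq_abs, ← norm_smul, EuclideanSpace.norm_eq,
    EuclideanSpace.norm_eq]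
  gcongr with i
  have := hφ.dist_le_mul (y i) (z i)
  simpa [Real.dist_eq, abs_mul] using this

/-- Coordinatewise comparison with `C • (one + w)`; the term `√N` is the norm of the all-ones
vector. -/
theorem norm_componentwise_le {C : ℝ} (hC : 0 ≤ C) (hφ : ∀ u, |φ u| ≤ C * (1 + |u|))
    (y : EuclideanSpace ℝ (Fin N)) :
    ‖(WithLp.toLp 2 (fun i => φ (y i)) : EuclideanSpace ℝ (Fin N))‖ ≤ C * (√N + ‖y‖) := by
  set one : EuclideanSpace ℝ (Fin N) := WithLp.toLp 2 fun _ => 1 with hone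
  set w : EuclideanSpace ℝ (Fin N) := WithLp.toLp 2 fun i => |y i| with hw
  have h1 : ‖one‖ = √N := by simp [EuclideanSpace.norm_eq, one]
  have h2 : ‖w‖ = ‖y‖ := by simp [EuclideanSpace.norm_eq, w]
  calc _ ≤ ‖C • (one + w)‖ := by
        rw [EuclideanSpace.norm_eq, EuclideanSpace.norm_eq]
        gcongr with i
        refine (hφ (y i)).trans (le_of_eq_of_le ?_ (le_abs_self _))
        simp [one, w, mul_add]
    _ ≤ C * (√N + ‖y‖) := by
        rw [norm_smul, Real.norm_of_nonneg hC, ← h1, ← h2]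
        gcongr
        exact norm_add_le _ _

theorem Weights.field_eq (θ : Weights d N) (φ : ℝ → ℝ) (k : Fin d)
    (y : EuclideanSpace ℝ (Fin N)) :
    θ.field φ k y = Matrix.toEuclideanCLM (𝕜 := ℝ) (θ.mat k) (WithLp.toLp 2 fun i => φ (y i)) +
      WithLp.toLp 2 (θ.bias k) := by
  rw [Matrix.toEuclideanCLM_toLp]
  rfl

/-- The vector field `∑ₖ ẋᵏ_s (A_k φ(y) + b_k)` driving the neural controlled differential
equation. -/
def drivenField (φ : ℝ → ℝ) (x : CMPath d) (θ : Weights d N) (s : ℝ)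
    (y : EuclideanSpace ℝ (Fin N)) : EuclideanSpace ℝ (Fin N) :=
  ∑ k, x.velocity s k • θ.field φ k y

theorem norm_drivenField_sub_le {L : ℝ≥0} (hφ : LipschitzWith L φ) (x : CMPath d)
    (θ : Weights d N) (s : ℝ) (y z : EuclideanSpace ℝ (Fin N)) :
    ‖drivenField φ x θ s y - drivenField φ x θ s z‖ ≤
      ‖x.velocity s‖ * (θ.matNorm * L) * ‖y - z‖ := by
  unfold drivenField Weights.matNorm
  rw [← Finset.sum_sub_distrib, Finset.sum_mul, Finset.mul_sum, Finset.sum_mul]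
  refine norm_sum_le_of_le _ fun k _ => ?_
  rw [← smul_sub, norm_smul, θ.field_eq, θ.field_eq, add_sub_add_right_eq_sub, ← map_sub, mul_assoc,
    mul_assoc]
  gcongr
  · exact PiLp.norm_apply_le _ _
  · refine (ContinuousLinearMap.le_opNorm _ _).trans ?_
    gcongr
    exact norm_componentwise_sub_le hφ y z

/-- The affine terms are collected into `‖y‖ + √N + biasNorm`, a quantity that an Euler step then
increases only by a factor. The coefficients are general because both the velocity and the
increments of the path are inserted. -/
theorem sum_norm_smul_field_le {C : ℝ} (hC : 0 ≤ C) (hφ : ∀ u, |φ u| ≤ C * (1 + |u|))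
    (θ : Weights d N) {c : Fin d → ℝ} {m : ℝ} (hc : ∀ k, |c k| ≤ m) (hm : 0 ≤ m)
    (y : EuclideanSpace ℝ (Fin N)) :
    ∑ k, ‖c k • θ.field φ k y‖ ≤ m * ((C * θ.matNorm + 1) * (‖y‖ + √N + θ.biasNorm)) := by
  calc ∑ k, ‖c k • θ.field φ k y‖
      ≤ ∑ k, m * (‖Matrix.toEuclideanCLM (𝕜 := ℝ) (θ.mat k)‖ * (C * (√N + ‖y‖)) +
          ‖(WithLp.toLp 2 (θ.bias k) : EuclideanSpace ℝ (Fin N))‖) := by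
        refine Finset.sum_le_sum fun k _ => ?_
        rw [norm_smul, θ.field_eq]
        gcongr
        · exact hc k
        · refine norm_add_le_of_le ((ContinuousLinearMap.le_opNorm _ _).trans ?_) le_rfl
          gcongr
          exact norm_componentwise_le hC hφ y
    _ = m * (θ.matNorm * (C * (√N + ‖y‖)) + θ.biasNorm) := by
        rw [← Finset.mul_sum, Finset.sum_add_distrib, ← Finset.sum_mul]; rfl
    _ ≤ _ := by
        gcongr
        have h1 := θ.matNorm_nonneg
        have h2 := θ.biasNorm_nonneg
        have h3 : 0 ≤ C * θ.matNorm * θ.biasNorm := by positivity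
        have h4 := norm_nonneg y
        have h5 := Real.sqrt_nonneg (N : ℝ)
        nlinarith

theorem norm_drivenField_le {C : ℝ} (hC : 0 ≤ C) (hφ : ∀ u, |φ u| ≤ C * (1 + |u|))
    (x : CMPath d) (θ : Weights d N) (s : ℝ) (y : EuclideanSpace ℝ (Fin N)) :
    ‖drivenField φ x θ s y‖ ≤
      ‖x.velocity s‖ * ((C * θ.matNorm + 1) * (‖y‖ + √N + θ.biasNorm)) :=
  (norm_sum_le _ _).trans (sum_norm_smul_field_le hC hφ θ
    (fun k => PiLp.norm_apply_le (x.velocity s) k) (norm_nonneg _) y)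

theorem continuous_field (hφ : Continuous φ) (k : Fin d) :
    Continuous fun p : Weights d N × EuclideanSpace ℝ (Fin N) => p.1.field φ k p.2 := by
  unfold Weights.field Weights.mat Weights.bias
  have h1 : Continuous fun p : Weights d N × EuclideanSpace ℝ (Fin N) =>
      (Matrix.of (p.1.2.2.1 k) : Matrix (Fin N) (Fin N) ℝ) :=
    continuous_matrix fun i j => by simp only [Matrix.of_apply]; fun_prop
  have h2 : Continuous fun p : Weights d N × EuclideanSpace ℝ (Fin N) => fun i => φ (p.2 i) := by
    fun_prop
  exact (PiLp.continuous_toLp 2 _).comp ((h1.matrix_mulVec h2).add (by fun_prop))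

/-- The driving field along a bounded measurable curve is integrable. -/
theorem intervalIntegrable_smul_field (hφ : Continuous φ) {C : ℝ} (hC : 0 ≤ C)
    (hφC : ∀ u, |φ u| ≤ C * (1 + |u|)) (x : CMPath d) (θ : Weights d N)
    {S : ℝ → EuclideanSpace ℝ (Fin N)} {B : ℝ}
    (hS : AEStronglyMeasurable S (volume.restrict (Icc 0 1)))
    (hB : ∀ s ∈ Icc (0 : ℝ) 1, ‖S s‖ ≤ B) (k : Fin d) :
    IntervalIntegrable (fun s => x.velocity s k • θ.field φ k (S s)) volume 0 1 := by
  have hfield : Continuous (θ.field φ k) :=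
    (continuous_field hφ k).comp (Continuous.prodMk_right θ)
  have hv := x.intervalIntegrable_velocity
  rw [intervalIntegrable_iff_integrableOn_Icc_of_le zero_le_one] at hv ⊢
  have hvk : AEStronglyMeasurable (fun s => x.velocity s k) (volume.restrict (Icc 0 1)) :=
    (EuclideanSpace.proj k : EuclideanSpace ℝ (Fin d) →L[ℝ] ℝ).continuous.comp_aestronglyMeasurable
      hv.aestronglyMeasurable
  refine Integrable.mono' (hv.norm.mul_const ((C * θ.matNorm + 1) * (B + √N + θ.biasNorm)))
    (hvk.smul (hfield.comp_aestronglyMeasurable hS)) ?_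
  refine (ae_restrict_mem measurableSet_Icc).mono fun s hs => ?_
  refine (Finset.single_le_sum (f := fun k => ‖x.velocity s k • θ.field φ k (S s)‖)
    (fun _ _ => norm_nonneg _) (Finset.mem_univ k)).trans ?_
  refine (sum_norm_smul_field_le hC hφC θ
    (fun k => PiLp.norm_apply_le (x.velocity s) k) (norm_nonneg _) _).trans ?_
  have := θ.matNorm_nonneg
  gcongr
  exact hB s hs

theorem sum_integral_eq_integral_drivenField {x : CMPath d} {θ : Weights d N}
    {S : ℝ → EuclideanSpace ℝ (Fin N)}
    (h : ∀ k, IntervalIntegrable (fun s => x.velocity s k • θ.field φ k (S s)) volume 0 1)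
    {t : ℝ} (ht : t ∈ Icc (0 : ℝ) 1) :
    ∑ k, ∫ s in (0 : ℝ)..t, x.velocity s k • θ.field φ k (S s) =
      ∫ s in (0 : ℝ)..t, drivenField φ x θ s (S s) := by
  unfold drivenField
  rw [intervalIntegral.integral_finsetSum]
  intro k _
  refine (h k).mono_set ?_
  rw [uIcc_of_le (zero_le_one' ℝ), uIcc_of_le ht.1]
  exact Icc_subset_Icc_right ht.2

theorem intervalIntegrable_drivenField {x : CMPath d} {θ : Weights d N}
    {S : ℝ → EuclideanSpace ℝ (Fin N)}
    (h : ∀ k, IntervalIntegrable (fun s => x.velocity s k • θ.field φ k (S s)) volume 0 1) :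
    IntervalIntegrable (fun s => drivenField φ x θ s (S s)) volume 0 1 := by
  simpa [drivenField, Finset.sum_fn] using IntervalIntegrable.sum Finset.univ fun k _ => h k

theorem intervalIntegrable_smul_field_of_continuousOn (hφ : Continuous φ) {C : ℝ} (hC : 0 ≤ C)
    (hφC : ∀ u, |φ u| ≤ C * (1 + |u|)) (x : CMPath d) (θ : Weights d N)
    {S : ℝ → EuclideanSpace ℝ (Fin N)} (hS : ContinuousOn S (Icc 0 1)) (k : Fin d) :
    IntervalIntegrable (fun s => x.velocity s k • θ.field φ k (S s)) volume 0 1 := by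
  obtain ⟨B, hB⟩ := isCompact_Icc.exists_bound_of_continuousOn hS
  exact intervalIntegrable_smul_field hφ hC hφC x θ
    (hS.aestronglyMeasurable measurableSet_Icc) hB k

theorem isNeuralCDESolution_iff (hφ : Continuous φ) {C : ℝ} (hC : 0 ≤ C)
    (hφC : ∀ u, |φ u| ≤ C * (1 + |u|)) (x : CMPath d) (θ : Weights d N)
    (S : ℝ → EuclideanSpace ℝ (Fin N)) :
    IsNeuralCDESolution φ x θ S ↔ ContinuousOn S (Icc 0 1) ∧ ∀ t ∈ Icc (0 : ℝ) 1,
      S t = θ.init + ∫ s in (0 : ℝ)..t, drivenField φ x θ s (S s) := by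
  refine and_congr_right fun hS => forall₂_congr fun t ht => ?_
  rw [sum_integral_eq_integral_drivenField
    (intervalIntegrable_smul_field_of_continuousOn hφ hC hφC x θ hS) ht]

variable {L : ℝ≥0} {C : ℝ}

theorem exists_isNeuralCDESolution (hL : LipschitzWith L φ) (hC : 0 ≤ C)
    (hφC : ∀ u, |φ u| ≤ C * (1 + |u|)) (x : CMPath d) (θ : Weights d N) :
    ∃ S, IsNeuralCDESolution φ x θ S := by
  simp only [isNeuralCDESolution_iff hL.continuous hC hφC]
  have := θ.matNorm_nonneg
  exact exists_continuousOn_eq_add_integral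
    (x.intervalIntegrable_velocity.norm.mul_const (θ.matNorm * L)) (fun s => by positivity)
    (fun S hS => intervalIntegrable_drivenField
      (intervalIntegrable_smul_field_of_continuousOn hL.continuous hC hφC x θ hS))
    (fun s y z => norm_drivenField_sub_le hL x θ s y z) θ.init

theorem isNeuralCDESolution_neuralCDEState (hL : LipschitzWith L φ) (hC : 0 ≤ C)
    (hφC : ∀ u, |φ u| ≤ C * (1 + |u|)) (x : CMPath d) (θ : Weights d N) :
    IsNeuralCDESolution φ x θ (neuralCDEState φ x θ) := by
  have h := exists_isNeuralCDESolution hL hC hφC x θ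
  rw [neuralCDEState, dif_pos h]
  exact h.choose_spec

/-- Stability: if `T` solves the equation up to replacing the state in the vector field by a
curve `Z` which is `ε`-close to `T`, then `T` is close to the solution. -/
theorem norm_sub_le_of_perturbed (hL : LipschitzWith L φ) {x : CMPath d} {θ : Weights d N}
    {S T Z : ℝ → EuclideanSpace ℝ (Fin N)} {a : EuclideanSpace ℝ (Fin N)} {ε : ℝ}
    (hS : ContinuousOn S (Icc 0 1)) (hT : ContinuousOn T (Icc 0 1))
    (hSi : IntervalIntegrable (fun s => drivenField φ x θ s (S s)) volume 0 1)
    (hZi : IntervalIntegrable (fun s => drivenField φ x θ s (Z s)) volume 0 1)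
    (hSe : ∀ t ∈ Icc (0 : ℝ) 1, S t = a + ∫ s in (0 : ℝ)..t, drivenField φ x θ s (S s))
    (hTe : ∀ t ∈ Icc (0 : ℝ) 1, T t = a + ∫ s in (0 : ℝ)..t, drivenField φ x θ s (Z s))
    (hε : 0 ≤ ε) (hZ : ∀ t ∈ Icc (0 : ℝ) 1, ‖T t - Z t‖ ≤ ε) {t : ℝ} (ht : t ∈ Icc (0 : ℝ) 1) :
    ‖T t - S t‖ ≤ 2 * ε * Real.exp (2 * (x.pathNorm * (θ.matNorm * L))) := by
  have hα := θ.matNorm_nonneg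
  have hg := x.intervalIntegrable_velocity.norm.mul_const (θ.matNorm * L)
  -- Adding `ε` absorbs the perturbation into the kernel: `‖S - Z‖ ≤ ‖T - S‖ + ε`.
  have hu : ContinuousOn (fun t => ‖T t - S t‖ + ε) (Icc 0 1) :=
    (hT.sub hS).norm.add continuousOn_const
  have hgr := le_mul_exp_of_le_add_integral_mul (c := ε) hg (fun s => by positivity) hu hε ?_ ht
  · refine (le_add_of_nonneg_right hε).trans (hgr.trans ?_)
    rw [intervalIntegral.integral_mul_const]
    gcongr
    exact x.integral_norm_velocity_le_pathNorm ht
  intro t ht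
  have hsub : uIcc (0 : ℝ) t ⊆ Icc 0 1 := by
    rw [uIcc_of_le ht.1]; exact Icc_subset_Icc_right ht.2
  have hsub' : uIcc (0 : ℝ) t ⊆ uIcc 0 1 := by rwa [uIcc_of_le (zero_le_one' ℝ)]
  rw [hTe t ht, hSe t ht, add_sub_add_left_eq_sub,
    ← intervalIntegral.integral_sub (hZi.mono_set hsub') (hSi.mono_set hsub'), add_comm]
  gcongr
  refine intervalIntegral.norm_integral_le_of_norm_le ht.1 (Filter.Eventually.of_forall
    fun s hs => ?_) ((hg.mono_set hsub').mul_continuousOn (hu.mono hsub))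
  have hs' : s ∈ Icc (0 : ℝ) 1 := ⟨hs.1.le, hs.2.trans ht.2⟩
  refine (norm_drivenField_sub_le hL x θ s _ _).trans ?_
  gcongr
  rw [norm_sub_rev]
  calc ‖S s - Z s‖ = ‖(T s - Z s) - (T s - S s)‖ := by congr 1; abel
    _ ≤ ‖T s - S s‖ + ε := by
      rw [add_comm]; exact (norm_sub_le _ _).trans (by gcongr; exact hZ s hs')

/-- Stability with `Z = T` and `ε = 0`. -/
theorem eqOn_of_isNeuralCDESolution (hL : LipschitzWith L φ) (hC : 0 ≤ C)
    (hφC : ∀ u, |φ u| ≤ C * (1 + |u|)) {x : CMPath d} {θ : Weights d N}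
    {S T : ℝ → EuclideanSpace ℝ (Fin N)} (hS : IsNeuralCDESolution φ x θ S)
    (hT : IsNeuralCDESolution φ x θ T) : EqOn T S (Icc 0 1) := by
  intro t ht
  have hi {S : ℝ → EuclideanSpace ℝ (Fin N)} (hS : IsNeuralCDESolution φ x θ S) :=
    intervalIntegrable_drivenField
      (intervalIntegrable_smul_field_of_continuousOn hL.continuous hC hφC x θ hS.1)
  have h := norm_sub_le_of_perturbed hL hS.1 hT.1 (hi hS) (hi hT)
    ((isNeuralCDESolution_iff hL.continuous hC hφC x θ S).1 hS).2
    ((isNeuralCDESolution_iff hL.continuous hC hφC x θ T).1 hT).2 le_rfl (by simp) ht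
  simp only [mul_zero, zero_mul, norm_le_zero_iff, sub_eq_zero] at h
  exact h

end VectorField
end

/-! ### The ResNet: pathwise error and measurability. -/

noncomputable section

section ResNet

variable {d N : ℕ} {φ : ℝ → ℝ} {L : ℝ≥0} {C : ℝ}

theorem measurable_resNetPiecewise (x : CMPath d) (D : UnitPartition) (θ : Weights d N) :
    Measurable (resNetPiecewise φ x D θ) :=
  (measurable_of_countable (resNetGrid φ x D θ)).comp D.measurable_index

theorem exists_norm_resNetPiecewise_le (x : CMPath d) (D : UnitPartition) (θ : Weights d N) :
    ∃ B, ∀ s, ‖resNetPiecewise φ x D θ s‖ ≤ B := by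
  obtain ⟨B, hB⟩ := ((Finset.range (D.size + 1)).image
    fun i => ‖resNetGrid φ x D θ i‖).bddAbove
  exact ⟨B, fun s => hB (by
    simp only [Finset.coe_image, Finset.coe_range]
    exact ⟨D.index s, Nat.lt_succ_of_le (D.index_le s), rfl⟩)⟩

theorem intervalIntegrable_smul_field_resNetPiecewise (hφ : Continuous φ) (hC : 0 ≤ C)
    (hφC : ∀ u, |φ u| ≤ C * (1 + |u|)) (x : CMPath d) (D : UnitPartition) (θ : Weights d N)
    (k : Fin d) :
    IntervalIntegrable (fun s => x.velocity s k • θ.field φ k (resNetPiecewise φ x D θ s))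
      volume 0 1 := by
  obtain ⟨B, hB⟩ := exists_norm_resNetPiecewise_le (φ := φ) x D θ
  exact intervalIntegrable_smul_field hφ hC hφC x θ
    (measurable_resNetPiecewise x D θ).aestronglyMeasurable (fun s _ => hB s) k

theorem resNetState_eq (hφ : Continuous φ) (hC : 0 ≤ C) (hφC : ∀ u, |φ u| ≤ C * (1 + |u|))
    (x : CMPath d) (D : UnitPartition) (θ : Weights d N) {t : ℝ} (ht : t ∈ Icc (0 : ℝ) 1) :
    resNetState φ x D θ t =
      θ.init + ∫ s in (0 : ℝ)..t, drivenField φ x θ s (resNetPiecewise φ x D θ s) := by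
  rw [resNetState, sum_integral_eq_integral_drivenField
    (intervalIntegrable_smul_field_resNetPiecewise hφ hC hφC x D θ) ht]

theorem continuousOn_resNetState (hφ : Continuous φ) (hC : 0 ≤ C)
    (hφC : ∀ u, |φ u| ≤ C * (1 + |u|)) (x : CMPath d) (D : UnitPartition) (θ : Weights d N) :
    ContinuousOn (resNetState φ x D θ) (Icc 0 1) :=
  (continuousOn_const.add (intervalIntegrable_drivenField
    (intervalIntegrable_smul_field_resNetPiecewise hφ hC hφC x D θ)).continuousOn_primitive_Icc).congr
    fun _ ht => resNetState_eq hφ hC hφC x D θ ht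

/-- Between consecutive grid points the field is frozen, so each integral is an increment of the
path times a constant vector. -/
theorem resNetState_pt (hφ : Continuous φ) (hC : 0 ≤ C) (hφC : ∀ u, |φ u| ≤ C * (1 + |u|))
    (x : CMPath d) (D : UnitPartition) (θ : Weights d N) {i : ℕ} (hi : i ≤ D.size) :
    resNetState φ x D θ (D.pt i) = resNetGrid φ x D θ i := by
  induction i with
  | zero => simp [resNetState, D.pt_zero, resNetGrid]
  | succ i ih =>
    have h0 : (0 : ℝ) ∈ Icc (0 : ℝ) 1 := by simp
    have hm := D.pt_mem (i := i) (by omega)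
    have hm' := D.pt_mem hi
    rw [resNetGrid, ← ih (by omega), resNetState, resNetState, add_assoc, ← Finset.sum_add_distrib]
    congr 1
    refine Finset.sum_congr rfl fun k _ => ?_
    have hint {s t : ℝ} (hs : s ∈ Icc (0 : ℝ) 1) (ht : t ∈ Icc (0 : ℝ) 1) :=
      (intervalIntegrable_smul_field_resNetPiecewise hφ hC hφC x D θ k).mono_set (c := s) (d := t)
        (by rw [uIcc_of_le (zero_le_one' ℝ)]; exact ordConnected_Icc.uIcc_subset hs ht)
    rw [← intervalIntegral.integral_add_adjacent_intervals (hint h0 hm) (hint hm hm'),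
      ← x.integral_velocity_apply hm hm' k, ← intervalIntegral.integral_smul_const]
    congr 1
    have hlt := D.pt_lt i hi
    -- At the right endpoint the index has already advanced, so this null point is removed.
    rw [intervalIntegral.integral_of_le hlt.le, intervalIntegral.integral_of_le hlt.le,
      integral_Ioc_eq_integral_Ioo, integral_Ioc_eq_integral_Ioo]
    refine setIntegral_congr_fun measurableSet_Ioo fun s hs => ?_
    simp only [resNetPiecewise, D.index_eq hi hs.1.le hs.2, ← ih (by omega), resNetState]

/-- Discrete Grönwall: a step over which the path has length `δ` multiplies the left side by at most
`1 + κ δ ≤ exp (κ δ)`, with `κ = C * matNorm + 1`. -/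
theorem norm_resNetGrid_le (hC : 0 ≤ C) (hφC : ∀ u, |φ u| ≤ C * (1 + |u|))
    (x : CMPath d) (D : UnitPartition) (θ : Weights d N) {i : ℕ} (hi : i ≤ D.size) :
    ‖resNetGrid φ x D θ i‖ + √N + θ.biasNorm ≤
      Real.exp ((C * θ.matNorm + 1) * x.pathNorm) * (‖θ.init‖ + √N + θ.biasNorm) := by
  have hα := θ.matNorm_nonneg
  have hβ := θ.biasNorm_nonneg
  have h0 : (0 : ℝ) ∈ Icc (0 : ℝ) 1 := by simp
  -- The induction needs the length up to `t_i` in the exponent, since lengths add along the grid;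
  -- only at the end is it replaced by `pathNorm`.
  suffices h : ‖resNetGrid φ x D θ i‖ + √N + θ.biasNorm ≤
      Real.exp ((C * θ.matNorm + 1) * ∫ s in (0 : ℝ)..D.pt i, ‖x.velocity s‖) *
        (‖θ.init‖ + √N + θ.biasNorm) by
    refine h.trans ?_
    gcongr
    exact x.integral_norm_velocity_le_pathNorm (D.pt_mem hi)
  induction i with
  | zero => simp [resNetGrid, D.pt_zero]
  | succ i ih =>
    have hm := D.pt_mem (i := i) (by omega)
    have hm' := D.pt_mem hi
    have hlt := D.pt_lt i hi
    rw [← intervalIntegral.integral_add_adjacent_intervals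
      (x.intervalIntegrable_norm_velocity h0 hm) (x.intervalIntegrable_norm_velocity hm hm')]
    set δ := ∫ s in D.pt i..D.pt (i + 1), ‖x.velocity s‖ with hδ
    have hδ0 : 0 ≤ δ := intervalIntegral.integral_nonneg hlt.le fun _ _ => norm_nonneg _
    have hinc : ∀ k, |x.toFun (D.pt (i + 1)) k - x.toFun (D.pt i) k| ≤ δ := fun k => by
      rw [← x.integral_velocity_apply hm hm' k]
      exact intervalIntegral.norm_integral_le_of_norm_le hlt.le
        (Filter.Eventually.of_forall fun s _ => PiLp.norm_apply_le (x.velocity s) k)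
        (x.intervalIntegrable_norm_velocity hm hm')
    have hstep := (norm_add_le (resNetGrid φ x D θ i) _).trans
      (add_le_add_right ((norm_sum_le _ _).trans (sum_norm_smul_field_le hC hφC θ hinc hδ0
        (resNetGrid φ x D θ i))) _)
    rw [mul_add (C * θ.matNorm + 1), Real.exp_add]
    calc _ ≤ ((C * θ.matNorm + 1) * δ + 1) * (‖resNetGrid φ x D θ i‖ + √N + θ.biasNorm) := by
          rw [resNetGrid]
          linarith
      _ ≤ Real.exp ((C * θ.matNorm + 1) * δ) *
            (Real.exp ((C * θ.matNorm + 1) * ∫ s in (0 : ℝ)..D.pt i, ‖x.velocity s‖) *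
              (‖θ.init‖ + √N + θ.biasNorm)) := by
          gcongr
          · exact Real.add_one_le_exp _
          · exact ih (by omega)
      _ = _ := by ring

/-- The distance between the integral extension and the piecewise constant extension. -/
theorem norm_resNetState_sub_resNetPiecewise_le (hφ : Continuous φ) (hC : 0 ≤ C)
    (hφC : ∀ u, |φ u| ≤ C * (1 + |u|)) (x : CMPath d) (D : UnitPartition) (θ : Weights d N)
    {t : ℝ} (ht : t ∈ Icc (0 : ℝ) 1) :
    ‖resNetState φ x D θ t - resNetPiecewise φ x D θ t‖ ≤ √D.mesh * x.pathNorm *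
      ((C * θ.matNorm + 1) * (Real.exp ((C * θ.matNorm + 1) * x.pathNorm) *
        (‖θ.init‖ + √N + θ.biasNorm))) := by
  have hα := θ.matNorm_nonneg
  have hβ := θ.biasNorm_nonneg
  have h0 : (0 : ℝ) ∈ Icc (0 : ℝ) 1 := by simp
  have hm := D.pt_mem (D.index_le t)
  have hle := D.pt_index_le ht.1
  have hint {s t : ℝ} (hs : s ∈ Icc (0 : ℝ) 1) (ht : t ∈ Icc (0 : ℝ) 1) :=
    (intervalIntegrable_drivenField
      (intervalIntegrable_smul_field_resNetPiecewise hφ hC hφC x D θ)).mono_set (c := s) (d := t)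
      (by rw [uIcc_of_le (zero_le_one' ℝ)]; exact ordConnected_Icc.uIcc_subset hs ht)
  rw [resNetPiecewise, ← resNetState_pt hφ hC hφC x D θ (D.index_le t),
    resNetState_eq hφ hC hφC x D θ ht, resNetState_eq hφ hC hφC x D θ hm, add_sub_add_left_eq_sub,
    intervalIntegral.integral_interval_sub_left (hint h0 ht) (hint h0 hm)]
  refine (intervalIntegral.norm_integral_le_of_norm_le hle (Filter.Eventually.of_forall
    fun s _ => ?_) ((x.intervalIntegrable_norm_velocity hm ht).mul_const
      ((C * θ.matNorm + 1) * (Real.exp ((C * θ.matNorm + 1) * x.pathNorm) *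
        (‖θ.init‖ + √N + θ.biasNorm))))).trans ?_
  · refine (norm_drivenField_le hC hφC x θ s _).trans ?_
    gcongr
    exact norm_resNetGrid_le hC hφC x D θ (D.index_le s)
  · rw [intervalIntegral.integral_mul_const]
    gcongr
    refine (x.integral_norm_velocity_le hm.1 hle ht.2).trans ?_
    have := x.pathNorm_nonneg
    gcongr
    exact D.sub_pt_index_le_mesh ht

/-- The pathwise error of the controlled ResNet. -/
theorem norm_resNetState_sub_neuralCDEState_le (hL : LipschitzWith L φ) (hC : 0 ≤ C)
    (hφC : ∀ u, |φ u| ≤ C * (1 + |u|)) (x : CMPath d) (D : UnitPartition) (θ : Weights d N)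
    {t : ℝ} (ht : t ∈ Icc (0 : ℝ) 1) :
    ‖resNetState φ x D θ t - neuralCDEState φ x θ t‖ ≤ 2 * (√D.mesh * x.pathNorm *
      ((C * θ.matNorm + 1) * (Real.exp ((C * θ.matNorm + 1) * x.pathNorm) *
        (‖θ.init‖ + √N + θ.biasNorm)))) * Real.exp (2 * (x.pathNorm * (θ.matNorm * L))) := by
  have hS := isNeuralCDESolution_neuralCDEState hL hC hφC x θ
  have hα := θ.matNorm_nonneg
  have hβ := θ.biasNorm_nonneg
  have hr := x.pathNorm_nonneg
  exact norm_sub_le_of_perturbed hL hS.1 (continuousOn_resNetState hL.continuous hC hφC x D θ)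
    (intervalIntegrable_drivenField
      (intervalIntegrable_smul_field_of_continuousOn hL.continuous hC hφC x θ hS.1))
    (intervalIntegrable_drivenField
      (intervalIntegrable_smul_field_resNetPiecewise hL.continuous hC hφC x D θ))
    ((isNeuralCDESolution_iff hL.continuous hC hφC x θ _).1 hS).2
    (fun t ht => resNetState_eq hL.continuous hC hφC x D θ ht) (by positivity)
    (fun t ht => norm_resNetState_sub_resNetPiecewise_le hL.continuous hC hφC x D θ ht) ht

theorem continuous_init : Continuous (Weights.init : Weights d N → EuclideanSpace ℝ (Fin N)) :=
  (PiLp.continuous_toLp 2 _).comp (by fun_prop)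

theorem continuous_readoutVec :
    Continuous (Weights.readoutVec : Weights d N → EuclideanSpace ℝ (Fin N)) :=
  (PiLp.continuous_toLp 2 _).comp (by fun_prop)

theorem continuous_resNetGrid (hφ : Continuous φ) (x : CMPath d) (D : UnitPartition) (i : ℕ) :
    Continuous fun θ : Weights d N => resNetGrid φ x D θ i := by
  induction i with
  | zero => exact continuous_init
  | succ i ih =>
    simp only [resNetGrid]
    refine ih.add (continuous_finsetSum _ fun k _ => ?_)
    have h : Continuous fun θ : Weights d N => θ.field φ k (resNetGrid φ x D θ i) :=
      (continuous_field hφ k).comp (continuous_id.prodMk ih)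
    exact h.const_smul (x.toFun (D.pt (i + 1)) k - x.toFun (D.pt i) k)

/-- The velocity is only a.e. strongly measurable, so a measurable representative replaces it before
Fubini measurability is used. -/
theorem measurable_integral_velocity_smul {α E : Type*} [MeasurableSpace α]
    [NormedAddCommGroup E] [NormedSpace ℝ E] [MeasurableSpace E] [BorelSpace E]
    [SecondCountableTopology E] {h : α × ℝ → E} (hh : Measurable h) (x : CMPath d) (k : Fin d)
    {t : ℝ} (ht : t ∈ Icc (0 : ℝ) 1) :
    Measurable fun a => ∫ s in (0 : ℝ)..t, x.velocity s k • h (a, s) := by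
  have hvm : AEStronglyMeasurable x.velocity (volume.restrict (Ioc 0 t)) :=
    x.memLp_velocity.aestronglyMeasurable.mono_measure
      (Measure.restrict_mono (Ioc_subset_Icc_self.trans (Icc_subset_Icc_right ht.2)) le_rfl)
  have hv : Measurable fun p : α × ℝ => (hvm.mk x.velocity p.2) k :=
    (EuclideanSpace.proj k : EuclideanSpace ℝ (Fin d) →L[ℝ] ℝ).continuous.measurable.comp
      (hvm.stronglyMeasurable_mk.measurable.comp measurable_snd)
  have hint := (hv.smul hh).stronglyMeasurable.integral_prod_right' (ν := volume.restrict (Ioc 0 t))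
  have heq : (fun a => ∫ s in (0 : ℝ)..t, x.velocity s k • h (a, s)) =
      fun a => ∫ s in Ioc 0 t, (hvm.mk x.velocity s) k • h (a, s) := by
    funext a
    rw [intervalIntegral.integral_of_le ht.1]
    refine integral_congr_ae ?_
    filter_upwards [hvm.ae_eq_mk] with s hs
    rw [hs]
  rw [heq]
  exact hint.measurable

theorem measurable_field_comp {α : Type*} [MeasurableSpace α] (hφ : Continuous φ) (k : Fin d)
    {a : α → Weights d N} {b : α → EuclideanSpace ℝ (Fin N)} (ha : Measurable a)
    (hb : Measurable b) : Measurable fun p => (a p).field φ k (b p) := by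
  have h := (continuous_field (d := d) (N := N) hφ k).measurable
  generalize hF : (fun p : Weights d N × EuclideanSpace ℝ (Fin N) => p.1.field φ k p.2) = F at h
  have heq : (fun p => (a p).field φ k (b p)) = fun p => F (a p, b p) := by rw [← hF]
  rw [heq]
  exact h.comp (ha.prodMk hb)

theorem measurable_resNetState (hφ : Continuous φ) (x : CMPath d) (D : UnitPartition) {t : ℝ}
    (ht : t ∈ Icc (0 : ℝ) 1) : Measurable fun θ : Weights d N => resNetState φ x D θ t := by
  -- Time enters only through the countable index, so measurability in the weights for each fixed
  -- index gives joint measurability.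
  have hZ : Measurable fun p : Weights d N × ℝ => resNetPiecewise φ x D p.1 p.2 := by
    have : Measurable fun p : Weights d N × ℕ => resNetGrid φ x D p.1 p.2 :=
      measurable_from_prod_countable_left fun i => (continuous_resNetGrid hφ x D i).measurable
    exact this.comp (measurable_fst.prodMk (D.measurable_index.comp measurable_snd))
  simp only [resNetState]
  exact continuous_init.measurable.add (Finset.measurable_fun_sum _ fun k _ =>
    measurable_integral_velocity_smul (measurable_field_comp hφ k measurable_fst hZ) x k ht)

theorem measurable_resNetReadout (hφ : Continuous φ) (x : CMPath d) (D : UnitPartition) {t : ℝ}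
    (ht : t ∈ Icc (0 : ℝ) 1) : Measurable (resNetReadout (N := N) φ x D t) :=
  continuous_readoutVec.measurable.inner (measurable_resNetState hφ x D ht)

/-- The solution is picked by choice, so its definition says nothing about dependence on the
weights; the pathwise error estimate exhibits it as a pointwise limit of ResNet states. -/
theorem measurable_neuralCDEState (hL : LipschitzWith L φ) (hC : 0 ≤ C)
    (hφC : ∀ u, |φ u| ≤ C * (1 + |u|)) (x : CMPath d) {t : ℝ} (ht : t ∈ Icc (0 : ℝ) 1) :
    Measurable fun θ : Weights d N => neuralCDEState φ x θ t := by
  refine measurable_of_tendsto_metrizable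
    (fun n => measurable_resNetState hL.continuous x (UnitPartition.uniform n) ht)
    (tendsto_pi_nhds.2 fun θ => ?_)
  rw [tendsto_iff_norm_sub_tendsto_zero]
  refine squeeze_zero (fun _ => norm_nonneg _)
    (fun n => norm_resNetState_sub_neuralCDEState_le hL hC hφC x _ θ ht) ?_
  have hm : Filter.Tendsto (fun n => √(UnitPartition.uniform n).mesh) Filter.atTop (nhds 0) := by
    rw [← Real.sqrt_zero]
    exact (squeeze_zero (fun n => (UnitPartition.uniform n).mesh_nonneg)
      UnitPartition.mesh_uniform_le tendsto_one_div_add_atTop_nhds_zero_nat).sqrt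
  simpa using (((hm.mul_const _).mul_const _).const_mul 2).mul_const _

theorem measurable_neuralCDEReadout (hL : LipschitzWith L φ) (hC : 0 ≤ C)
    (hφC : ∀ u, |φ u| ≤ C * (1 + |u|)) (x : CMPath d) {t : ℝ} (ht : t ∈ Icc (0 : ℝ) 1) :
    Measurable (neuralCDEReadout (N := N) φ x t) :=
  continuous_readoutVec.measurable.inner (measurable_neuralCDEState hL hC hφC x ht)

end ResNet
end

/-! ### Gaussian linear forms and vectors. -/

section Gaussian

theorem lintegral_pi_prod_eq_prod_lintegral {ι : Type*} [Fintype ι] {X : ι → Type*}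
    [∀ i, MeasurableSpace (X i)] (μ : ∀ i, Measure (X i)) [∀ i, IsProbabilityMeasure (μ i)]
    {f : ∀ i, X i → ℝ≥0∞} (hf : ∀ i, Measurable (f i)) :
    ∫⁻ x, ∏ i, f i (x i) ∂Measure.pi μ = ∏ i, ∫⁻ y, f i y ∂μ i := by
  rw [lintegral_prod_eq_prod_lintegral_of_indepFun _ (fun i (x : ∀ i, X i) => f i (x i))
    (iIndepFun_pi fun i => (hf i).aemeasurable)
    fun i => (hf i).comp (measurable_pi_apply i)]
  refine Finset.prod_congr rfl fun i _ => ?_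
  exact (measurePreserving_eval μ i).lintegral_comp (hf i)

theorem ofReal_exp_sum {ι : Type*} (s : Finset ι) (f : ι → ℝ) :
    ENNReal.ofReal (Real.exp (∑ i ∈ s, f i)) = ∏ i ∈ s, ENNReal.ofReal (Real.exp (f i)) := by
  rw [Real.exp_sum, ENNReal.ofReal_prod_of_nonneg fun _ _ => (Real.exp_pos _).le]

theorem lintegral_exp_mul_gaussianReal (v : ℝ≥0) (c : ℝ) :
    ∫⁻ x, ENNReal.ofReal (Real.exp (c * x)) ∂gaussianReal 0 v =
      ENNReal.ofReal (Real.exp (v * c ^ 2 / 2)) := by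
  rw [← ofReal_integral_eq_lintegral_ofReal (integrable_exp_mul_gaussianReal c)
    (Filter.Eventually.of_forall fun _ => (Real.exp_pos _).le)]
  have := congrFun (mgf_fun_id_gaussianReal (μ := 0) (v := v)) c
  simp only [mgf, zero_mul, zero_add] at this
  rw [this]

theorem lintegral_exp_sum_mul_gaussian {ι : Type*} [Fintype ι] (v : ℝ≥0) (c : ι → ℝ) :
    ∫⁻ g, ENNReal.ofReal (Real.exp (∑ i, c i * g i)) ∂Measure.pi (fun _ : ι => gaussianReal 0 v) =
      ENNReal.ofReal (Real.exp (v * (∑ i, c i ^ 2) / 2)) := by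
  simp_rw [ofReal_exp_sum]
  rw [lintegral_pi_prod_eq_prod_lintegral (fun _ : ι => gaussianReal 0 v)
    (f := fun i y => ENNReal.ofReal (Real.exp (c i * y))) fun i => by fun_prop]
  simp_rw [lintegral_exp_mul_gaussianReal]
  rw [← ofReal_exp_sum, Finset.mul_sum, Finset.sum_div]

theorem lintegral_exp_sum_sum_mul_gaussian {ι κ : Type*} [Fintype ι] [Fintype κ] (v : ℝ≥0)
    (c : ι → κ → ℝ) :
    ∫⁻ g, ENNReal.ofReal (Real.exp (∑ i, ∑ j, c i j * g i j))
      ∂Measure.pi (fun _ : ι => Measure.pi fun _ : κ => gaussianReal 0 v) =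
      ENNReal.ofReal (Real.exp (v * (∑ i, ∑ j, c i j ^ 2) / 2)) := by
  simp_rw [ofReal_exp_sum Finset.univ fun i => ∑ j, c i j * _]
  rw [lintegral_pi_prod_eq_prod_lintegral (fun _ : ι => Measure.pi fun _ : κ => gaussianReal 0 v)
    (f := fun i y => ENNReal.ofReal (Real.exp (∑ j, c i j * y j))) fun i => by fun_prop]
  simp_rw [lintegral_exp_sum_mul_gaussian]
  rw [← ofReal_exp_sum, Finset.mul_sum, Finset.sum_div]

/-- The first absolute moment of a Gaussian linear form. -/
theorem lintegral_abs_sum_mul_gaussian_le {ι : Type*} [Fintype ι] (v : ℝ≥0) (c : ι → ℝ) :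
    ∫⁻ g, ENNReal.ofReal |∑ i, c i * g i| ∂Measure.pi (fun _ : ι => gaussianReal 0 v) ≤
      ENNReal.ofReal (4 * √(v * ∑ i, c i ^ 2)) := by
  set q := (v : ℝ) * ∑ i, c i ^ 2 with hq
  have hq0 : 0 ≤ q := by positivity
  -- From `|w| ≤ exp w + exp (-w)` with `w` the form divided by `s`; the scale `s` stays free.
  have key : ∀ s : ℝ, 0 < s → ∫⁻ g, ENNReal.ofReal |∑ i, c i * g i|
      ∂Measure.pi (fun _ : ι => gaussianReal 0 v) ≤
      ENNReal.ofReal (s * (2 * Real.exp (q / s ^ 2 / 2))) := fun s hs => by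
    have hle : ∀ g : ι → ℝ, ENNReal.ofReal |∑ i, c i * g i| ≤
        ENNReal.ofReal s * (ENNReal.ofReal (Real.exp (∑ i, (c i / s) * g i)) +
          ENNReal.ofReal (Real.exp (∑ i, (-c i / s) * g i))) := fun g => by
      rw [← ENNReal.ofReal_add (Real.exp_pos _).le (Real.exp_pos _).le, ← ENNReal.ofReal_mul hs.le]
      refine ENNReal.ofReal_le_ofReal ?_
      have h1 : ∑ i, (c i / s) * g i = (∑ i, c i * g i) / s := by
        rw [Finset.sum_div]; exact Finset.sum_congr rfl fun i _ => by ring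
      have h2 : ∑ i, (-c i / s) * g i = -((∑ i, c i * g i) / s) := by
        rw [Finset.sum_div, ← Finset.sum_neg_distrib]
        exact Finset.sum_congr rfl fun i _ => by ring
      rw [h1, h2, ← div_le_iff₀' hs]
      set w := (∑ i, c i * g i) / s with hw
      have h3 : |∑ i, c i * g i| / s = |w| := by rw [hw, abs_div, abs_of_pos hs]
      rw [h3]
      refine abs_le.2 ⟨?_, ?_⟩
      · linarith [Real.add_one_le_exp (-w), Real.exp_pos w]
      · linarith [Real.add_one_le_exp w, Real.exp_pos (-w)]
    refine (lintegral_mono hle).trans ?_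
    rw [lintegral_const_mul _ (by fun_prop), lintegral_add_left (by fun_prop),
      lintegral_exp_sum_mul_gaussian, lintegral_exp_sum_mul_gaussian,
      ← ENNReal.ofReal_add (Real.exp_pos _).le (Real.exp_pos _).le, ← ENNReal.ofReal_mul hs.le]
    refine ENNReal.ofReal_le_ofReal (le_of_eq ?_)
    simp only [div_pow, neg_sq, ← Finset.sum_div]
    rw [hq, two_mul, ← mul_div_assoc]
  -- If the variance `q` vanishes, let `s → 0`. Otherwise `s = √q` gives `2 * exp (1 / 2) * √q`, and
  -- `exp (1 / 2) ≤ 2`.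
  rcases hq0.eq_or_lt with h0 | h0
  · rw [← h0]
    simp only [Real.sqrt_zero, mul_zero, ENNReal.ofReal_zero]
    refine ge_of_tendsto (x := nhdsWithin (0 : ℝ) (Ioi 0))
      (f := fun s => ENNReal.ofReal (s * 2)) ?_ ?_
    · have : Filter.Tendsto (fun s : ℝ => ENNReal.ofReal (s * 2)) (nhds 0)
          (nhds (ENNReal.ofReal (0 * 2))) :=
        ENNReal.tendsto_ofReal (Filter.tendsto_id.mul_const 2)
      simp only [zero_mul, ENNReal.ofReal_zero] at this
      exact this.mono_left nhdsWithin_le_nhds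
    · filter_upwards [self_mem_nhdsWithin] with s hs
      simpa [← h0] using key s hs
  · refine (key (√q) (Real.sqrt_pos.2 h0)).trans (ENNReal.ofReal_le_ofReal ?_)
    rw [Real.sq_sqrt hq0, div_self h0.ne', mul_comm 4]
    gcongr
    have h1 : Real.exp (1 / 2) ^ 2 = Real.exp 1 := by
      rw [← Real.exp_nat_mul]; norm_num
    have := Real.exp_one_lt_d9
    nlinarith [Real.exp_pos (1 / 2)]

/-- The mean Euclidean norm of a Gaussian vector, normalised by the square root of the
dimension. -/
theorem lintegral_norm_div_sqrt_le {N : ℕ} (hN : 1 ≤ N) (v : ℝ≥0) :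
    ∫⁻ g, ENNReal.ofReal (‖(WithLp.toLp 2 g : EuclideanSpace ℝ (Fin N))‖ / √N)
      ∂Measure.pi (fun _ : Fin N => gaussianReal 0 v) ≤ 1 + v := by
  have hN' : (0 : ℝ) < N := by exact_mod_cast hN
  have hsq : ∫⁻ x, ENNReal.ofReal (x ^ 2) ∂gaussianReal 0 v = v := by
    have h1 := evariance_eq_lintegral_ofReal id (gaussianReal 0 v)
    rw [← ofReal_variance (memLp_id_gaussianReal' 2 (by norm_num)), variance_id_gaussianReal] at h1
    simpa using h1.symm
  -- Since `z ≤ 1 + z ^ 2`, second moments suffice.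
  have hle : ∀ g : Fin N → ℝ,
      ENNReal.ofReal (‖(WithLp.toLp 2 g : EuclideanSpace ℝ (Fin N))‖ / √N) ≤
      1 + ENNReal.ofReal (1 / N) * ∑ i, ENNReal.ofReal (g i ^ 2) := fun g => by
    rw [← ENNReal.ofReal_sum_of_nonneg fun _ _ => sq_nonneg _, ← ENNReal.ofReal_mul (by positivity),
      ← ENNReal.ofReal_one, ← ENNReal.ofReal_add zero_le_one (by positivity)]
    refine ENNReal.ofReal_le_ofReal ?_
    have h1 : (‖(WithLp.toLp 2 g : EuclideanSpace ℝ (Fin N))‖ / √N) ^ 2 = 1 / N * ∑ i, g i ^ 2 := by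
      rw [div_pow, EuclideanSpace.norm_sq_eq, Real.sq_sqrt hN'.le]
      simp [div_eq_inv_mul]
    rw [← h1]
    nlinarith [sq_nonneg (‖(WithLp.toLp 2 g : EuclideanSpace ℝ (Fin N))‖ / √N - 1),
      sq_nonneg (‖(WithLp.toLp 2 g : EuclideanSpace ℝ (Fin N))‖ / √N)]
  refine (lintegral_mono hle).trans ?_
  rw [lintegral_add_left measurable_const, lintegral_const_mul _ (by fun_prop),
    lintegral_finsetSum _ fun i _ => by fun_prop]
  have : ∀ i : Fin N, ∫⁻ g, ENNReal.ofReal (g i ^ 2)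
      ∂Measure.pi (fun _ : Fin N => gaussianReal 0 v) = v := fun i => by
    rw [← hsq]
    exact (measurePreserving_eval (fun _ : Fin N => gaussianReal 0 v) i).lintegral_comp
      (f := fun x => ENNReal.ofReal (x ^ 2)) (by fun_prop)
  simp only [this, lintegral_const, measure_univ, mul_one, Finset.sum_const, Finset.card_univ,
    Fintype.card_fin, nsmul_eq_mul]
  rw [← mul_assoc, ← ENNReal.ofReal_natCast N, ← ENNReal.ofReal_mul (by positivity),
    one_div_mul_cancel hN'.ne']
  simp

end Gaussian

/-! ### The operator norm through averages of the bilinear form. -/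

section OperatorNorm

variable {E : Type*} [NormedAddCommGroup E] [InnerProductSpace ℝ E]

/-- Take an almost maximising `v` and `u = T v / ‖T v‖`. Any factor below `1` would be available; `7
/ 8` leaves room for the perturbation below. -/
theorem ContinuousLinearMap.exists_inner_ge_opNorm (T : E →L[ℝ] E) :
    ∃ u v : E, ‖u‖ ≤ 1 ∧ ‖v‖ ≤ 1 ∧ 7 / 8 * ‖T‖ ≤ inner ℝ u (T v) := by
  rcases (norm_nonneg T).eq_or_lt with h | h
  · exact ⟨0, 0, by simp, by simp, by simp [← h]⟩
  · obtain ⟨v, hv1, hv⟩ := T.exists_lt_apply_of_lt_opNorm (show 7 / 8 * ‖T‖ < ‖T‖ by linarith)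
    have hpos : 0 < ‖T v‖ := lt_of_le_of_lt (by positivity) hv
    refine ⟨‖T v‖⁻¹ • T v, v, ?_, hv1.le, ?_⟩
    · rw [norm_smul, norm_inv, norm_norm, inv_mul_cancel₀ hpos.ne']
    · rw [real_inner_smul_left, real_inner_self_eq_norm_sq, pow_two,
        inv_mul_cancel_left₀ hpos.ne']
      exact hv.le

/-- Moving `u` and `v` by `1 / 8` costs at most `1 / 8 + 9 / 64` of `‖T‖`, and `7 / 8 - 17 / 64 ≥ 1
/ 2`. A set of positive volume can thus replace the usual net argument. -/
theorem ContinuousLinearMap.exists_half_opNorm_le_inner (T : E →L[ℝ] E) :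
    ∃ u v : E, ‖u‖ ≤ 1 ∧ ‖v‖ ≤ 1 ∧
      ∀ u' ∈ Metric.ball u (1 / 8), ∀ v' ∈ Metric.ball v (1 / 8), ‖T‖ / 2 ≤ inner ℝ u' (T v') := by
  obtain ⟨u, v, hu, hv, huv⟩ := T.exists_inner_ge_opNorm
  refine ⟨u, v, hu, hv, fun u' hu' v' hv' => ?_⟩
  rw [mem_ball_iff_norm] at hu' hv'
  have hT := norm_nonneg T
  have h1 : |inner ℝ (u' - u) (T v)| ≤ 1 / 8 * (‖T‖ * 1) :=
    (abs_real_inner_le_norm _ _).trans (by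
      gcongr
      exact T.le_opNorm_of_le hv)
  have hun : ‖u'‖ ≤ 9 / 8 := by
    calc ‖u'‖ = ‖(u' - u) + u‖ := by rw [sub_add_cancel]
      _ ≤ 1 / 8 + 1 := norm_add_le_of_le hu'.le hu
      _ = 9 / 8 := by norm_num
  have h2 : |inner ℝ u' (T (v' - v))| ≤ 9 / 8 * (‖T‖ * (1 / 8)) :=
    (abs_real_inner_le_norm _ _).trans (by
      gcongr
      exact T.le_opNorm_of_le hv'.le)
  have h3 : inner ℝ u' (T v') = inner ℝ u (T v) + inner ℝ (u' - u) (T v) +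
      inner ℝ u' (T (v' - v)) := by
    rw [map_sub, inner_sub_right, inner_sub_left]; ring
  rw [h3]
  linarith [(abs_le.1 h1).1, (abs_le.1 h2).1]

variable [FiniteDimensional ℝ E] [MeasurableSpace E] [BorelSpace E]

/-- The exponential of the operator norm is controlled by an average over balls of exponentials of
the bilinear form. -/
theorem exp_opNorm_mul_volume_le (T : E →L[ℝ] E) {l : ℝ} (hl : 0 ≤ l) :
    ENNReal.ofReal (Real.exp (l * (‖T‖ / 2))) * volume (Metric.ball (0 : E) (1 / 8)) ^ 2 ≤
      ∫⁻ p, ENNReal.ofReal (Real.exp (l * inner ℝ p.1 (T p.2)))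
        ∂((volume.restrict (Metric.ball (0 : E) 2)).prod (volume.restrict (Metric.ball (0 : E) 2))) := by
  obtain ⟨u, v, hu, hv, h⟩ := T.exists_half_opNorm_le_inner
  -- The centres depend on `T`, but the small balls lie in one ball independent of `T`; this allows
  -- exchanging the average with the expectation over `T`.
  have hsub : ∀ w : E, ‖w‖ ≤ 1 → Metric.ball w (1 / 8) ⊆ Metric.ball 0 2 := fun w hw =>
    Metric.ball_subset_ball' (by rw [dist_zero_right]; linarith)
  rw [Measure.prod_restrict]
  calc _ = ∫⁻ _ in Metric.ball u (1 / 8) ×ˢ Metric.ball v (1 / 8),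
          ENNReal.ofReal (Real.exp (l * (‖T‖ / 2))) ∂((volume : Measure E).prod volume) := by
        rw [setLIntegral_const, Measure.prod_prod, Measure.addHaar_ball_center volume u,
          Measure.addHaar_ball_center volume v, pow_two]
    _ ≤ ∫⁻ p in Metric.ball u (1 / 8) ×ˢ Metric.ball v (1 / 8),
          ENNReal.ofReal (Real.exp (l * inner ℝ p.1 (T p.2))) ∂((volume : Measure E).prod volume) := by
        refine setLIntegral_mono' (measurableSet_ball.prod measurableSet_ball) fun p hp => ?_
        gcongr
        exact h _ hp.1 _ hp.2
    _ ≤ _ := lintegral_mono_set (Set.prod_mono (hsub u hu) (hsub v hv))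

theorem volume_ball_two_eq :
    volume (Metric.ball (0 : E) 2) =
      16 ^ Module.finrank ℝ E * volume (Metric.ball (0 : E) (1 / 8)) := by
  rw [Measure.addHaar_ball_of_pos volume (0 : E) (by norm_num : (0 : ℝ) < 2),
    Measure.addHaar_ball_of_pos volume (0 : E) (by norm_num : (0 : ℝ) < 1 / 8), ← mul_assoc]
  congr 1
  have : (16 : ℝ≥0∞) = ENNReal.ofReal 16 := by simp
  rw [this, ← ENNReal.ofReal_pow (by norm_num), ← ENNReal.ofReal_mul (by positivity), ← mul_pow]
  norm_num

end OperatorNorm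

/-! ### Exponential moments of Gaussian matrices, uniform in the dimension. -/

section GaussianMatrix

variable {N : ℕ}

theorem continuous_toEuclideanCLM_of :
    Continuous fun A : Fin N → Fin N → ℝ => Matrix.toEuclideanCLM (𝕜 := ℝ) (Matrix.of A) := by
  let f : (Fin N → Fin N → ℝ) →ₗ[ℝ] (EuclideanSpace ℝ (Fin N) →L[ℝ] EuclideanSpace ℝ (Fin N)) :=
    { toFun := fun A => Matrix.toEuclideanCLM (𝕜 := ℝ) (Matrix.of A)
      map_add' := fun A B => map_add (Matrix.toEuclideanCLM (𝕜 := ℝ)) (Matrix.of A) (Matrix.of B)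
      map_smul' := fun c A => map_smul (Matrix.toEuclideanCLM (𝕜 := ℝ)) c (Matrix.of A) }
  exact f.continuous_of_finiteDimensional

/-- The law of a square matrix with independent centred Gaussian entries of variance `w`. -/
noncomputable abbrev gaussianMatrix (N : ℕ) (w : ℝ≥0) : Measure (Fin N → Fin N → ℝ) :=
  Measure.pi fun _ => Measure.pi fun _ => gaussianReal 0 w

/-- The exponent is a linear form in the independent entries with coefficients `l * u i * v j`,
whose squares sum to `l ^ 2 * ‖u‖ ^ 2 * ‖v‖ ^ 2`. -/
theorem lintegral_exp_inner_gaussianMatrix (w : ℝ≥0) (l : ℝ) (u v : EuclideanSpace ℝ (Fin N)) :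
    ∫⁻ A, ENNReal.ofReal (Real.exp (l * inner ℝ u (Matrix.toEuclideanCLM (𝕜 := ℝ) (Matrix.of A) v)))
      ∂gaussianMatrix N w = ENNReal.ofReal (Real.exp (w * l ^ 2 * (‖u‖ ^ 2 * ‖v‖ ^ 2) / 2)) := by
  have h : ∀ A : Fin N → Fin N → ℝ,
      l * inner ℝ u (Matrix.toEuclideanCLM (𝕜 := ℝ) (Matrix.of A) v) =
        ∑ i, ∑ j, (l * u i * v j) * A i j := fun A => by
    rw [Matrix.inner_toEuclideanCLM]
    simp only [dotProduct, Matrix.mulVec, Matrix.of_apply, Finset.mul_sum]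
    exact Finset.sum_congr rfl fun i _ => Finset.sum_congr rfl fun j _ => by ring
  simp_rw [h]
  rw [lintegral_exp_sum_sum_mul_gaussian]
  congr 3
  rw [EuclideanSpace.norm_sq_eq, EuclideanSpace.norm_sq_eq, Finset.sum_mul_sum, mul_assoc]
  congr 1
  rw [Finset.mul_sum]
  refine Finset.sum_congr rfl fun i _ => ?_
  rw [Finset.mul_sum]
  refine Finset.sum_congr rfl fun j _ => ?_
  simp only [Real.norm_eq_abs, sq_abs]
  ring

/-- The exponential moment of order `l` of the operator norm of a Gaussian matrix. -/
theorem lintegral_exp_half_opNorm_gaussianMatrix_le (w : ℝ≥0) {l : ℝ} (hl : 0 ≤ l) :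
    ∫⁻ A, ENNReal.ofReal (Real.exp (l * (‖Matrix.toEuclideanCLM (𝕜 := ℝ) (Matrix.of A)‖ / 2)))
      ∂gaussianMatrix N w ≤ 256 ^ N * ENNReal.ofReal (Real.exp (8 * (w * l ^ 2))) := by
  set V := volume (Metric.ball (0 : EuclideanSpace ℝ (Fin N)) (1 / 8)) with hV
  have hV0 : V ≠ 0 := (Metric.measure_ball_pos volume _ (by norm_num)).ne'
  have hVt : V ≠ ∞ := measure_ball_lt_top.ne
  have hV2 : volume (Metric.ball (0 : EuclideanSpace ℝ (Fin N)) 2) = 16 ^ N * V := by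
    rw [volume_ball_two_eq, finrank_euclideanSpace_fin]
  set ν := (volume.restrict (Metric.ball (0 : EuclideanSpace ℝ (Fin N)) 2)).prod
    (volume.restrict (Metric.ball (0 : EuclideanSpace ℝ (Fin N)) 2)) with hν
  have hνu : ν univ = 256 ^ N * V ^ 2 := by
    rw [hν, ← univ_prod_univ, Measure.prod_prod, Measure.restrict_apply_univ, hV2]
    have : (256 : ℝ≥0∞) = 16 * 16 := by norm_num
    rw [this, mul_pow]
    ring
  have hcont : Continuous fun q : (Fin N → Fin N → ℝ) ×
      (EuclideanSpace ℝ (Fin N) × EuclideanSpace ℝ (Fin N)) =>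
      ENNReal.ofReal (Real.exp (l * inner ℝ q.2.1
        (Matrix.toEuclideanCLM (𝕜 := ℝ) (Matrix.of q.1) q.2.2))) := by
    refine ENNReal.continuous_ofReal.comp (Real.continuous_exp.comp (continuous_const.mul
      (continuous_snd.fst.inner ?_)))
    exact (continuous_toEuclideanCLM_of.comp continuous_fst).clm_apply continuous_snd.snd
  have hmeas : Measurable fun A : Fin N → Fin N → ℝ => ENNReal.ofReal
      (Real.exp (l * (‖Matrix.toEuclideanCLM (𝕜 := ℝ) (Matrix.of A)‖ / 2))) := by
    have h := (continuous_toEuclideanCLM_of (N := N)).norm.measurable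
    fun_prop
  -- After multiplication by `V ^ 2` the averaging bound applies. Tonelli then takes the Gaussian
  -- expectation for fixed `u, v` of norm at most `2`, which gives `8 = 2 ^ 2 * 2 ^ 2 / 2`.
  refine (ENNReal.mul_le_mul_iff_left (pow_ne_zero 2 hV0) (ENNReal.pow_ne_top hVt)).1 ?_
  rw [← lintegral_mul_const _ hmeas]
  refine (lintegral_mono fun A => exp_opNorm_mul_volume_le _ hl).trans ?_
  rw [lintegral_lintegral_swap hcont.measurable.aemeasurable]
  simp_rw [lintegral_exp_inner_gaussianMatrix]
  calc _ ≤ ∫⁻ _, ENNReal.ofReal (Real.exp (8 * (w * l ^ 2))) ∂ν := by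
        refine lintegral_mono_ae ?_
        rw [Measure.prod_restrict]
        filter_upwards [ae_restrict_mem (measurableSet_ball.prod measurableSet_ball)] with p hp
        refine ENNReal.ofReal_le_ofReal (Real.exp_le_exp.2 ?_)
        have h1 : ‖p.1‖ ≤ 2 := (mem_ball_zero_iff.1 hp.1).le
        have h2 : ‖p.2‖ ≤ 2 := (mem_ball_zero_iff.1 hp.2).le
        calc (w : ℝ) * l ^ 2 * (‖p.1‖ ^ 2 * ‖p.2‖ ^ 2) / 2 ≤ w * l ^ 2 * (2 ^ 2 * 2 ^ 2) / 2 := by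
              gcongr
          _ = _ := by ring
    _ = _ := by rw [lintegral_const, hνu]; ring

/-- Jensen's inequality for powers. -/
theorem lintegral_le_of_lintegral_pow_le {α : Type*} [MeasurableSpace α] {μ : Measure α}
    [IsProbabilityMeasure μ] {f : α → ℝ≥0∞} (hf : AEMeasurable f μ) {n : ℕ} (hn : 1 ≤ n) {B : ℝ≥0∞}
    (h : ∫⁻ a, f a ^ n ∂μ ≤ B ^ n) : ∫⁻ a, f a ∂μ ≤ B := by
  rcases hn.eq_or_lt with rfl | hn
  · simpa using h
  have hn0 : (n : ℝ) ≠ 0 := by positivity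
  have := ENNReal.lintegral_mul_le_Lp_mul_Lq μ
    (Real.HolderConjugate.conjExponent (by exact_mod_cast hn : (1 : ℝ) < n)) hf
    (aemeasurable_const (b := 1))
  simp only [Pi.mul_apply, mul_one, ENNReal.one_rpow, lintegral_const, measure_univ,
    ENNReal.rpow_natCast] at this
  refine this.trans ((ENNReal.rpow_le_rpow h (by positivity)).trans ?_)
  rw [← ENNReal.rpow_natCast, ← ENNReal.rpow_mul, mul_one_div_cancel hn0, ENNReal.rpow_one]

/-- The exponential moments of the operator norm of a Gaussian matrix with entries of variance
`σ² / N` are bounded uniformly in the dimension. -/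
theorem lintegral_exp_opNorm_gaussianMatrix_le (hN : 1 ≤ N) (σ : ℝ) {c : ℝ} (hc : 0 ≤ c) :
    ∫⁻ A, ENNReal.ofReal (Real.exp (c * ‖Matrix.toEuclideanCLM (𝕜 := ℝ) (Matrix.of A)‖))
      ∂gaussianMatrix N (σ ^ 2 / (N : ℝ)).toNNReal ≤
      ENNReal.ofReal (256 * Real.exp (32 * (σ ^ 2 * c ^ 2))) := by
  have hN' : (0 : ℝ) < N := by exact_mod_cast hN
  refine lintegral_le_of_lintegral_pow_le ?_ hN ?_
  · have h := (continuous_toEuclideanCLM_of (N := N)).norm.measurable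
    exact Measurable.aemeasurable (by fun_prop)
  -- With `l = 2cN` the integrand is the `N`-th power of `exp (c‖A‖)`, and `8 * (σ² / N) * l² = N *
  -- 32 σ² c²`, so the bound is an `N`-th power as well.
  have h := lintegral_exp_half_opNorm_gaussianMatrix_le (N := N) (σ ^ 2 / (N : ℝ)).toNNReal
    (l := N * (2 * c)) (by positivity)
  calc _ = ∫⁻ A, ENNReal.ofReal (Real.exp (N * (2 * c) *
          (‖Matrix.toEuclideanCLM (𝕜 := ℝ) (Matrix.of A)‖ / 2)))
          ∂gaussianMatrix N (σ ^ 2 / (N : ℝ)).toNNReal := by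
        refine lintegral_congr fun A => ?_
        rw [← ENNReal.ofReal_pow (Real.exp_pos _).le, ← Real.exp_nat_mul]
        congr 2
        ring
    _ ≤ _ := h
    _ = _ := by
        rw [Real.coe_toNNReal _ (by positivity), ENNReal.ofReal_mul (by norm_num), mul_pow (ENNReal.ofReal 256),
          ← ENNReal.ofReal_pow (Real.exp_pos _).le, ← Real.exp_nat_mul]
        congr 3
        · simp
        · field_simp
          ring

end GaussianMatrix

/-! ### The expected cost of the coupling. -/

noncomputable section

section Expectation

variable {d N : ℕ} {φ : ℝ → ℝ} {L : ℝ≥0} {C : ℝ}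

theorem lintegral_exp_sum_opNorm_le (hN : 1 ≤ N) (σ : ℝ) {c : ℝ} (hc : 0 ≤ c) :
    ∫⁻ A, ENNReal.ofReal (Real.exp
        (c * ∑ k, ‖Matrix.toEuclideanCLM (𝕜 := ℝ) (Matrix.of (A k))‖))
      ∂Measure.pi (fun _ : Fin d => gaussianMatrix N (σ ^ 2 / (N : ℝ)).toNNReal) ≤
      ENNReal.ofReal ((256 * Real.exp (32 * (σ ^ 2 * c ^ 2))) ^ d) := by
  have h := (continuous_toEuclideanCLM_of (N := N)).norm.measurable
  simp_rw [Finset.mul_sum, ofReal_exp_sum]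
  rw [lintegral_pi_prod_eq_prod_lintegral
    (fun _ : Fin d => gaussianMatrix N (σ ^ 2 / (N : ℝ)).toNNReal)
    (f := fun _ A => ENNReal.ofReal
      (Real.exp (c * ‖Matrix.toEuclideanCLM (𝕜 := ℝ) (Matrix.of A)‖))) fun _ => by fun_prop,
    ENNReal.ofReal_pow (by positivity)]
  refine (Finset.prod_le_prod' fun _ _ => lintegral_exp_opNorm_gaussianMatrix_le hN σ hc).trans ?_
  simp

theorem lintegral_sum_norm_div_sqrt_le (hN : 1 ≤ N) (v : ℝ≥0) :
    ∫⁻ b, ENNReal.ofReal ((∑ k, ‖(WithLp.toLp 2 (b k) : EuclideanSpace ℝ (Fin N))‖) / √N)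
      ∂Measure.pi (fun _ : Fin d => Measure.pi fun _ : Fin N => gaussianReal 0 v) ≤
      d * (1 + v) := by
  simp_rw [Finset.sum_div]
  have hm : Measurable fun g : Fin N → ℝ =>
      ENNReal.ofReal (‖(WithLp.toLp 2 g : EuclideanSpace ℝ (Fin N))‖ / √N) := by fun_prop
  calc _ = ∫⁻ b, ∑ k, ENNReal.ofReal (‖(WithLp.toLp 2 (b k) : EuclideanSpace ℝ (Fin N))‖ / √N)
          ∂Measure.pi (fun _ : Fin d => Measure.pi fun _ : Fin N => gaussianReal 0 v) :=
        lintegral_congr fun b => ENNReal.ofReal_sum_of_nonneg fun _ _ => by positivity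
    _ = ∑ _ : Fin d, ∫⁻ g, ENNReal.ofReal (‖(WithLp.toLp 2 g : EuclideanSpace ℝ (Fin N))‖ / √N)
          ∂Measure.pi (fun _ : Fin N => gaussianReal 0 v) := by
        have hmk (k : Fin d) : Measurable fun b : Fin d → Fin N → ℝ =>
            ENNReal.ofReal (‖(WithLp.toLp 2 (b k) : EuclideanSpace ℝ (Fin N))‖ / √N) :=
          hm.comp (measurable_pi_apply k)
        rw [lintegral_finsetSum _ fun k _ => hmk k]
        exact Finset.sum_congr rfl fun k _ => (measurePreserving_eval
          (fun _ : Fin d => Measure.pi fun _ : Fin N => gaussianReal 0 v) k).lintegral_comp hm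
    _ ≤ ∑ _ : Fin d, (1 + (v : ℝ≥0∞)) :=
        Finset.sum_le_sum fun _ _ => lintegral_norm_div_sqrt_le hN v
    _ = _ := by simp [mul_add]

theorem lintegral_prod_prod_mul_add {α β γ : Type*} [MeasurableSpace α] [MeasurableSpace β]
    [MeasurableSpace γ] (μ : Measure α) (ν : Measure β) (κ : Measure γ) [IsProbabilityMeasure μ]
    [IsProbabilityMeasure ν] [IsProbabilityMeasure κ] {p : α → ℝ≥0∞} {f : β → ℝ≥0∞}
    {q : γ → ℝ≥0∞} (hp : Measurable p) (hf : Measurable f) (hq : Measurable q) :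
    ∫⁻ ω, f ω.2.1 * (p ω.1 + 1 + q ω.2.2) ∂μ.prod (ν.prod κ) =
      (∫⁻ b, f b ∂ν) * (∫⁻ a, p a ∂μ + 1 + ∫⁻ c, q c ∂κ) := by
  have hinner : ∀ a, ∫⁻ z, f z.1 * (p a + 1 + q z.2) ∂ν.prod κ =
      (∫⁻ b, f b ∂ν) * (p a + 1 + ∫⁻ c, q c ∂κ) := fun a => by
    rw [lintegral_prod_mul (f := f) (g := fun c => p a + 1 + q c) hf.aemeasurable
      (by fun_prop), lintegral_add_left measurable_const]
    simp
  rw [lintegral_prod _ (by fun_prop)]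
  simp_rw [hinner]
  rw [lintegral_const_mul _ (by fun_prop), lintegral_add_right _ measurable_const,
    lintegral_add_right _ measurable_const]
  simp

/-- The states do not see the readout vector; this is the independence of `v` and `y` used when `v`
is integrated first. -/
theorem resNetGrid_congr (x : CMPath d) (D : UnitPartition) {θ θ' : Weights d N}
    (h : θ.2 = θ'.2) (i : ℕ) : resNetGrid φ x D θ i = resNetGrid φ x D θ' i := by
  obtain ⟨v, ω⟩ := θ
  obtain ⟨v', ω'⟩ := θ'
  obtain rfl : ω = ω' := h
  induction i with
  | zero => rfl
  | succ i ih =>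
    rw [resNetGrid, resNetGrid, ih]
    rfl

theorem resNetState_congr (x : CMPath d) (D : UnitPartition) {θ θ' : Weights d N}
    (h : θ.2 = θ'.2) : resNetState φ x D θ = resNetState φ x D θ' := by
  funext t
  have hZ : resNetPiecewise φ x D θ = resNetPiecewise φ x D θ' :=
    funext fun s => resNetGrid_congr x D h _
  rw [resNetState, resNetState, hZ]
  simp only [Weights.init, Weights.field, Weights.mat, Weights.bias, h]

theorem neuralCDEState_congr (x : CMPath d) {θ θ' : Weights d N} (h : θ.2 = θ'.2) :
    neuralCDEState φ x θ = neuralCDEState φ x θ' := by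
  have : IsNeuralCDESolution φ x θ = IsNeuralCDESolution φ x θ' := by
    funext S
    simp only [IsNeuralCDESolution, Weights.init, Weights.field, Weights.mat, Weights.bias, h]
  unfold neuralCDEState
  rw [this]

/-- The joint law of `X` and `Y` is an admissible coupling. -/
theorem wasserstein1_map_le {Ω E : Type*} [MeasurableSpace Ω] [MeasurableSpace E]
    [PseudoEMetricSpace E] [OpensMeasurableSpace E] [SecondCountableTopology E]
    {P : Measure Ω} {X Y : Ω → E} (hX : Measurable X) (hY : Measurable Y) :
    wasserstein1 (P.map X) (P.map Y) ≤ ∫⁻ ω, edist (X ω) (Y ω) ∂P := by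
  refine (iInf₂_le (P.map fun ω => (X ω, Y ω))
    ⟨Measure.fst_map_prodMk hY, Measure.snd_map_prodMk hX⟩).trans (le_of_eq ?_)
  exact lintegral_map measurable_edist (hX.prodMk hY)

/-- The pathwise error of the controlled ResNet, in a form adapted to taking expectations. -/
theorem norm_resNetState_sub_neuralCDEState_div_sqrt_le (hN : 1 ≤ N) (hL : LipschitzWith L φ)
    (hC : 0 ≤ C) (hφC : ∀ u, |φ u| ≤ C * (1 + |u|)) (x : CMPath d) (D : UnitPartition)
    (θ : Weights d N) {t : ℝ} (ht : t ∈ Icc (0 : ℝ) 1) :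
    ‖resNetState φ x D θ t - neuralCDEState φ x θ t‖ / √N ≤
      2 * √D.mesh * x.pathNorm * Real.exp x.pathNorm *
        (Real.exp ((C + C * x.pathNorm + 2 * x.pathNorm * L) * θ.matNorm) *
          (‖θ.init‖ / √N + 1 + θ.biasNorm / √N)) := by
  have hN' : 0 < √(N : ℝ) := Real.sqrt_pos.2 (by exact_mod_cast hN)
  have hα := θ.matNorm_nonneg
  have hβ := θ.biasNorm_nonneg
  have hr := x.pathNorm_nonneg
  rw [div_le_iff₀ hN']
  refine (norm_resNetState_sub_neuralCDEState_le hL hC hφC x D θ ht).trans ?_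
  have h1 : (‖θ.init‖ / √N + 1 + θ.biasNorm / √N) * √N = ‖θ.init‖ + √N + θ.biasNorm := by
    field_simp
  -- The prefactor `C * matNorm + 1` is also bounded by an exponential, so that a single exponential
  -- moment of `matNorm` remains.
  have h2 : Real.exp x.pathNorm *
      Real.exp ((C + C * x.pathNorm + 2 * x.pathNorm * L) * θ.matNorm) =
      Real.exp (C * θ.matNorm) * Real.exp ((C * θ.matNorm + 1) * x.pathNorm) *
        Real.exp (2 * (x.pathNorm * (θ.matNorm * L))) := by
    rw [← Real.exp_add, ← Real.exp_add, ← Real.exp_add]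
    congr 1
    ring
  calc _ ≤ 2 * (√D.mesh * x.pathNorm * (Real.exp (C * θ.matNorm) *
        (Real.exp ((C * θ.matNorm + 1) * x.pathNorm) * (‖θ.init‖ + √N + θ.biasNorm)))) *
          Real.exp (2 * (x.pathNorm * (θ.matNorm * L))) := by
        gcongr
        exact Real.add_one_le_exp _
    _ = 2 * √D.mesh * x.pathNorm * (Real.exp (C * θ.matNorm) *
        Real.exp ((C * θ.matNorm + 1) * x.pathNorm) *
        Real.exp (2 * (x.pathNorm * (θ.matNorm * L)))) * (‖θ.init‖ + √N + θ.biasNorm) := by ring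
    _ = _ := by rw [← h1, ← h2]; ring

/-- The Monge-type cost of coupling the two readouts through the common weights. -/
theorem lintegral_edist_readout_le (hN : 1 ≤ N) (hL : LipschitzWith L φ)
    (hC : 0 ≤ C) (hφC : ∀ u, |φ u| ≤ C * (1 + |u|)) (σa σA σb : ℝ) (x : CMPath d)
    (D : UnitPartition) {t : ℝ} (ht : t ∈ Icc (0 : ℝ) 1) :
    ∫⁻ θ, edist (resNetReadout φ x D t θ) (neuralCDEReadout φ x t θ)
      ∂Weights.law d N σa σA σb ≤
      ENNReal.ofReal (4 * (2 * √D.mesh * x.pathNorm * Real.exp x.pathNorm) *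
        ((256 * Real.exp (32 * (σA ^ 2 * (C + C * x.pathNorm + 2 * x.pathNorm * L) ^ 2))) ^ d *
          ((1 + σa ^ 2) + 1 + d * (1 + σb ^ 2)))) := by
  have hN' : (0 : ℝ) < N := by exact_mod_cast hN
  have hr := x.pathNorm_nonneg
  set c := C + C * x.pathNorm + 2 * x.pathNorm * L with hc
  have hc0 : 0 ≤ c := by positivity
  set m := 4 * (2 * √D.mesh * x.pathNorm * Real.exp x.pathNorm) with hm
  have hm0 : 0 ≤ m := by positivity
  have hcl := (continuous_toEuclideanCLM_of (N := N)).norm.measurable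
  let p : (Fin N → ℝ) → ℝ≥0∞ := fun a =>
    ENNReal.ofReal (‖(WithLp.toLp 2 a : EuclideanSpace ℝ (Fin N))‖ / √N)
  let f : (Fin d → Fin N → Fin N → ℝ) → ℝ≥0∞ := fun A => ENNReal.ofReal (Real.exp
        (c * ∑ k, ‖Matrix.toEuclideanCLM (𝕜 := ℝ) (Matrix.of (A k))‖))
  let q : (Fin d → Fin N → ℝ) → ℝ≥0∞ := fun b =>
    ENNReal.ofReal ((∑ k, ‖(WithLp.toLp 2 (b k) : EuclideanSpace ℝ (Fin N))‖) / √N)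
  have hp : Measurable p := by fun_prop
  have hf : Measurable f := by
    have h (k : Fin d) : Measurable fun A : Fin d → Fin N → Fin N → ℝ =>
        ‖Matrix.toEuclideanCLM (𝕜 := ℝ) (Matrix.of (A k))‖ := hcl.comp (measurable_pi_apply k)
    fun_prop
  have hq : Measurable q := by fun_prop
  have hmeas : Measurable fun θ : Weights d N =>
      edist (resNetReadout φ x D t θ) (neuralCDEReadout φ x t θ) :=
    (measurable_resNetReadout hL.continuous x D ht).edist
      (measurable_neuralCDEReadout hL hC hφC x ht)
  unfold Weights.law
  -- Integrate over `v` first, with all other weights frozen.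
  rw [lintegral_prod_symm' _ hmeas]
  have hinner : ∀ ω : (Fin N → ℝ) × (Fin d → Fin N → Fin N → ℝ) × (Fin d → Fin N → ℝ),
      ∫⁻ v, edist (resNetReadout φ x D t (v, ω)) (neuralCDEReadout φ x t (v, ω))
        ∂Measure.pi (fun _ : Fin N => gaussianReal 0 (1 / (N : ℝ)).toNNReal) ≤
      ENNReal.ofReal m * (f ω.2.1 * (p ω.1 + 1 + q ω.2.2)) := fun ω => by
    set y := resNetState φ x D ((0, ω) : Weights d N) t -
      neuralCDEState φ x ((0, ω) : Weights d N) t with hy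
    have he : ∀ v : Fin N → ℝ, edist (resNetReadout φ x D t ((v, ω) : Weights d N))
        (neuralCDEReadout φ x t ((v, ω) : Weights d N)) = ENNReal.ofReal |∑ i, y i * v i| :=
      fun v => by
        rw [edist_dist, Real.dist_eq, resNetReadout, neuralCDEReadout, ← inner_sub_right,
          resNetState_congr x D (θ := (v, ω)) (θ' := (0, ω)) rfl,
          neuralCDEState_congr x (θ := (v, ω)) (θ' := (0, ω)) rfl, ← hy]
        simp [PiLp.inner_apply, Weights.readoutVec]
    simp_rw [he]
    refine (lintegral_abs_sum_mul_gaussian_le _ _).trans ?_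
    have hs : √(((1 / (N : ℝ)).toNNReal : ℝ) * ∑ i, y i ^ 2) = ‖y‖ / √N := by
      rw [Real.coe_toNNReal _ (by positivity), EuclideanSpace.norm_eq, ← Real.sqrt_div' _ hN'.le]
      congr 1
      simp only [Real.norm_eq_abs, sq_abs]
      ring
    have hbound := norm_resNetState_sub_neuralCDEState_div_sqrt_le hN hL hC hφC x D
      ((0, ω) : Weights d N) ht
    rw [hs, ← ENNReal.ofReal_one, ← ENNReal.ofReal_add (by positivity) zero_le_one,
      ← ENNReal.ofReal_add (by positivity) (by positivity),
      ← ENNReal.ofReal_mul (Real.exp_pos _).le, ← ENNReal.ofReal_mul hm0]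
    refine ENNReal.ofReal_le_ofReal ?_
    rw [hm, mul_assoc]
    exact mul_le_mul_of_nonneg_left hbound (by norm_num)
  refine (lintegral_mono hinner).trans ?_
  rw [lintegral_const_mul _ (by fun_prop), lintegral_prod_prod_mul_add _ _ _ hp hf hq,
    ENNReal.ofReal_mul hm0]
  gcongr
  rw [ENNReal.ofReal_mul (by positivity)]
  gcongr
  · exact lintegral_exp_sum_opNorm_le hN σA hc0
  rw [ENNReal.ofReal_add (by positivity) (by positivity), ENNReal.ofReal_add (by positivity)
    (by positivity), ENNReal.ofReal_add (by positivity) (by positivity), ENNReal.ofReal_mul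
    (by positivity), ENNReal.ofReal_add (by positivity) (by positivity), ENNReal.ofReal_natCast,
    ENNReal.ofReal_one]
  gcongr
  · exact lintegral_norm_div_sqrt_le hN _
  · exact lintegral_sum_norm_div_sqrt_le hN _

end Expectation

end

theorem mainTheorem8 (d : ℕ) (φ : ℝ → ℝ)
    (hLip : ∃ L : ℝ≥0, LipschitzWith L φ)
    (hLin : ∃ C : ℝ, 0 < C ∧ ∀ u : ℝ, |φ u| ≤ C * (1 + |u|))
    (σa σA σb : ℝ) (hσa : 0 ≤ σa) (hσA : 0 ≤ σA) (hσb : 0 ≤ σb) :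
    -- the neural controlled differential equation has a unique solution on `[0,1]`
    (∀ (N : ℕ) (x : CMPath d) (θ : Weights d N),
      IsNeuralCDESolution φ x θ (neuralCDEState φ x θ) ∧
        ∀ S, IsNeuralCDESolution φ x θ S → EqOn S (neuralCDEState φ x θ) (Icc 0 1)) ∧
    -- the readouts are random variables
    (∀ (N : ℕ) (x : CMPath d), ∀ t ∈ Icc (0 : ℝ) 1,
      (∀ D : UnitPartition, Measurable (resNetReadout (N := N) φ x D t)) ∧
        Measurable (neuralCDEReadout (N := N) φ x t)) ∧
    -- the bound
    ∃ K : ℝ → ℝ, Monotone K ∧ (∀ r, 0 < K r) ∧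
      ∀ (x : CMPath d) (D : UnitPartition),
        (⨆ (N : ℕ) (_ : 1 ≤ N) (t : ℝ) (_ : t ∈ Icc (0 : ℝ) 1),
            wasserstein1
              ((Weights.law d N σa σA σb).map (resNetReadout φ x D t))
              ((Weights.law d N σa σA σb).map (neuralCDEReadout φ x t)))
          ≤ ENNReal.ofReal (K x.pathNorm * √D.mesh) := by
  obtain ⟨L, hL⟩ := hLip
  obtain ⟨C, hC, hφC⟩ := hLin
  refine ⟨fun N x θ => ?_, fun N x t ht => ?_, ?_⟩
  · have h := isNeuralCDESolution_neuralCDEState hL hC.le hφC x θ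
    exact ⟨h, fun S hS => eqOn_of_isNeuralCDESolution hL hC.le hφC h hS⟩
  · exact ⟨fun D => measurable_resNetReadout hL.continuous x D ht,
      measurable_neuralCDEReadout hL hC.le hφC x ht⟩
  -- The truncation `max r 0` makes the bound monotone on all of `ℝ`, and the added `1` makes it
  -- positive even where the main term vanishes.
  · refine ⟨fun r => 8 * max r 0 * Real.exp (max r 0) *
      ((256 * Real.exp (32 * (σA ^ 2 * (C + C * max r 0 + 2 * max r 0 * L) ^ 2))) ^ d *
        ((1 + σa ^ 2) + 1 + d * (1 + σb ^ 2))) + 1, fun r s hrs => ?_, fun r => by positivity,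
      fun x D => ?_⟩
    · have h := max_le_max_right 0 hrs
      have h0 : 0 ≤ max r 0 := le_max_right _ _
      dsimp only
      gcongr
    · refine iSup₂_le fun N hN => iSup₂_le fun t ht => ?_
      refine (wasserstein1_map_le (measurable_resNetReadout hL.continuous x D ht)
        (measurable_neuralCDEReadout hL hC.le hφC x ht)).trans ?_
      refine (lintegral_edist_readout_le hN hL hC.le hφC σa σA σb x D ht).trans
        (ENNReal.ofReal_le_ofReal ?_)
      dsimp only
      rw [max_eq_left x.pathNorm_nonneg, add_mul]
      refine le_add_of_le_of_nonneg (le_of_eq ?_) (by positivity)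
      ring
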